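/- **Proposition 1 (Local stability).** Let $N\in\mathbb N$, and for $i\in\{1,\dots,N\}$ let $m_i\in(0,\infty)$ (masses) and $a_i,b_i\in[0,\infty)$ (intrinsic left and right jump rates). Let $X=(X(t))_{t\ge 0}$, $X(t)=(X_1(t),\dots,X_N(t))$, be the elastic particle system: the right-continuous continuous-time Markov chain on $\mathbb X_N=\{x\in\mathbb Z^N: x_1\le\cdots\le x_N\}$, started from a deterministic state $X(0)\in\mathbb X_N$, which from state $x$ jumps to $x-e_i$ at rate $A_i(x)$ and to $x+e_i$ at rate $B_i(x)$, where $e_i$ is the $i$-th unit vector and $$A_i(x)=\mathbf 1\{x_{i-1}<x_i\}\sum_{j=i}^N\frac{m_ja_j}{m_i}\mathbf 1\{x_j=x_i\},\qquad B_i(x)=\mathbf 1\{x_i<x_{i+1}\}\sum_{j=1}^i\frac{m_jb_j}{m_i}\mathbf 1\{x_j=x_i\},$$ with $x_0=-\infty$, $x_{N+1}=+\infty$. For $0\le\ell\le k\le N$ put $$U_{\ell,k}=-\sum_{i=\ell+1}^k m_i(b_i-a_i),\qquad M_{\ell,k}=\sum_{i=\ell+1}^k m_i .$$ Let $0\le \ell<r\le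 N$, let $\Delta(t)=\max_{\ell<i\le r}X_i(t)-\min_{\ell<i\le r}X_i(t)$ be the span of the particles $\ell+1,\dots,r$ at time $t$, and suppose that $$\frac{U_{\ell,k}}{M_{\ell,k}}<\frac{U_{\ell,r}}{M_{\ell,r}}\qquad\text{for all integers } k \text{ with } \ell<k<r .$$ Then there exist constants $C\in[0,\infty)$ and $\delta>0$, depending only on $N,\ell,r$ and the $a_i,b_i,m_i$ (in particular not on $X(0)$), such that $$\sup_{t\ge 0}\mathbb P[\Delta(t)\ge s]\le C\bigl[1+e^{C\Delta(0)}\bigr]e^{-\delta s}\qquad\text{for all } s\ge 0,$$ and, moreover, $$\limsup_{t\to\infty}\frac{\Delta(t)}{\log t}<\infty\quad\text{a.s.}$$ -/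

import Mathlib

open MeasureTheory Filter
open scoped NNReal BoundedContinuousFunction

noncomputable section

namespace Elastic

/-- The configuration space of `N` ordered particles on `ℤ`. The particle with label
`i ∈ {1, …, N}` is the element of `Fin N` with value `i - 1`. The topology is discrete. -/
abbrev Config (N : ℕ) : Type := {x : Fin N → ℤ // Monotone x}

/-- Particle `i` is the particle of smallest label at its site: `x_{i-1} < x_i`, where the
condition is void for the first particle. -/
def IsBottom {N : ℕ} (x : Config N) (i : Fin N) : Prop :=
  ∀ j : Fin N, (j : ℕ) + 1 = (i : ℕ) → x.1 j < x.1 i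

/-- Particle `i` is the particle of largest label at its site: `x_i < x_{i+1}`, where the
condition is void for the last particle. -/
def IsTop {N : ℕ} (x : Config N) (i : Fin N) : Prop :=
  ∀ j : Fin N, (i : ℕ) + 1 = (j : ℕ) → x.1 i < x.1 j

theorem IsBottom.monotone_sub {N : ℕ} {x : Config N} {i : Fin N} (h : IsBottom x i) :
    Monotone (x.1 - Pi.single i 1) := by
  intro j k hjk
  have hx := x.2 hjk
  simp only [Pi.sub_apply, Pi.single_apply]
  by_cases hk : k = i
  · subst hk
    by_cases hj : j = k
    · subst hj; simp
    · have hlt : (j : ℕ) < (k : ℕ) := by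
        have h1 : (j : ℕ) ≤ (k : ℕ) := hjk
        have h2 : (j : ℕ) ≠ (k : ℕ) := fun e => hj (Fin.ext e)
        omega
      have hk' := k.2
      have hl := h ⟨(k : ℕ) - 1, by omega⟩ (by simp only; omega)
      have hjl : x.1 j ≤ x.1 ⟨(k : ℕ) - 1, by omega⟩ := x.2 (by
        change (j : ℕ) ≤ (k : ℕ) - 1
        omega)
      simp only [hj, if_true, if_false]
      omega
  · simp only [hk, if_false]
    split_ifs <;> omega

theorem IsTop.monotone_add {N : ℕ} {x : Config N} {i : Fin N} (h : IsTop x i) :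
    Monotone (x.1 + Pi.single i 1) := by
  intro j k hjk
  have hx := x.2 hjk
  simp only [Pi.add_apply, Pi.single_apply]
  by_cases hj : j = i
  · subst hj
    by_cases hk : k = j
    · subst hk; simp
    · have hlt : (j : ℕ) < (k : ℕ) := by
        have h1 : (j : ℕ) ≤ (k : ℕ) := hjk
        have h2 : (k : ℕ) ≠ (j : ℕ) := fun e => hk (Fin.ext e)
        omega
      have hk' := k.2
      have hl := h ⟨(j : ℕ) + 1, by omega⟩ (by simp only)
      have hjl : x.1 ⟨(j : ℕ) + 1, by omega⟩ ≤ x.1 k := x.2 (by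
        change (j : ℕ) + 1 ≤ (k : ℕ)
        omega)
      simp only [hk, if_true, if_false]
      omega
  · simp only [hj, if_false]
    split_ifs <;> omega

/-- The configuration `x - e_i` (only used when `i` is the bottom particle of its site). -/
def jumpLeft {N : ℕ} (x : Config N) (i : Fin N) (h : IsBottom x i) : Config N :=
  ⟨x.1 - Pi.single i 1, h.monotone_sub⟩

/-- The configuration `x + e_i` (only used when `i` is the top particle of its site). -/
def jumpRight {N : ℕ} (x : Config N) (i : Fin N) (h : IsTop x i) : Config N :=
  ⟨x.1 + Pi.single i 1, h.monotone_add⟩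

/-- The sum `∑_{j ≥ i} (m_j a_j / m_i) 1{x_j = x_i}`: the rate at which particle `i` jumps to
the left when it is the bottom particle of its site. -/
def leftRate {N : ℕ} (m a : Fin N → ℝ) (x : Config N) (i : Fin N) : ℝ :=
  ∑ j : Fin N, if i ≤ j ∧ x.1 j = x.1 i then m j * a j / m i else 0

/-- The sum `∑_{j ≤ i} (m_j b_j / m_i) 1{x_j = x_i}`: the rate at which particle `i` jumps to
the right when it is the top particle of its site. -/
def rightRate {N : ℕ} (m b : Fin N → ℝ) (x : Config N) (i : Fin N) : ℝ :=
  ∑ j : Fin N, if j ≤ i ∧ x.1 j = x.1 i then m j * b j / m i else 0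

open Classical in
/-- The generator of the particle system applied to a function `f`: particle `i` jumps to the left
at rate `leftRate` if it is the bottom particle of its site, and to the right at rate
`rightRate` if it is the top particle of its site; there are no other transitions. -/
def genFun {N : ℕ} (m a b : Fin N → ℝ) (f : Config N → ℝ) (x : Config N) : ℝ :=
  ∑ i : Fin N,
    ((if h : IsBottom x i then leftRate m a x i * (f (jumpLeft x i h) - f x) else 0)
      + (if h : IsTop x i then rightRate m b x i * (f (jumpRight x i h) - f x) else 0))

/-- A crude bound for the total rate at which particle `i` jumps. -/
def rateBound {N : ℕ} (m a b : Fin N → ℝ) (i : Fin N) : ℝ :=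
  ∑ j : Fin N, |m j * a j / m i| + ∑ j : Fin N, |m j * b j / m i|

theorem abs_leftRate_le {N : ℕ} (m a : Fin N → ℝ) (x : Config N) (i : Fin N) :
    |leftRate m a x i| ≤ ∑ j : Fin N, |m j * a j / m i| := by
  refine (Finset.abs_sum_le_sum_abs _ _).trans (Finset.sum_le_sum fun j _ => ?_)
  split_ifs
  · exact le_rfl
  · simp

theorem abs_rightRate_le {N : ℕ} (m b : Fin N → ℝ) (x : Config N) (i : Fin N) :
    |rightRate m b x i| ≤ ∑ j : Fin N, |m j * b j / m i| := by
  refine (Finset.abs_sum_le_sum_abs _ _).trans (Finset.sum_le_sum fun j _ => ?_)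
  split_ifs
  · exact le_rfl
  · simp

theorem abs_genFun_le {N : ℕ} (m a b : Fin N → ℝ) (f : Config N →ᵇ ℝ) (x : Config N) :
    |genFun m a b f x| ≤ (∑ i, rateBound m a b i * 2) * ‖f‖ := by
  have hdiff : ∀ y z : Config N, |f y - f z| ≤ 2 * ‖f‖ := fun y z => by
    have := f.dist_le_two_norm y z
    rwa [Real.dist_eq] at this
  have h0 : 0 ≤ 2 * ‖f‖ := by positivity
  rw [Finset.sum_mul]
  refine (Finset.abs_sum_le_sum_abs _ _).trans (Finset.sum_le_sum fun i _ => ?_)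
  rw [rateBound, mul_assoc, add_mul]
  refine (abs_add_le _ _).trans (add_le_add ?_ ?_)
  · split_ifs with h
    · rw [abs_mul]
      exact mul_le_mul (abs_leftRate_le m a x i) (hdiff _ _) (abs_nonneg _)
        (Finset.sum_nonneg fun _ _ => abs_nonneg _)
    · rw [abs_zero]
      exact mul_nonneg (Finset.sum_nonneg fun _ _ => abs_nonneg _) h0
  · split_ifs with h
    · rw [abs_mul]
      exact mul_le_mul (abs_rightRate_le m b x i) (hdiff _ _) (abs_nonneg _)
        (Finset.sum_nonneg fun _ _ => abs_nonneg _)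
    · rw [abs_zero]
      exact mul_nonneg (Finset.sum_nonneg fun _ _ => abs_nonneg _) h0

/-- The generator as a bounded operator on the Banach space of bounded functions on the
configuration space (the jump rates are bounded). -/
def generator {N : ℕ} (m a b : Fin N → ℝ) : (Config N →ᵇ ℝ) →L[ℝ] (Config N →ᵇ ℝ) :=
  LinearMap.mkContinuous
    { toFun := fun f => BoundedContinuousFunction.ofNormedAddCommGroup (genFun m a b f)
        continuous_of_discreteTopology ((∑ i, rateBound m a b i * 2) * ‖f‖)
        (fun x => abs_genFun_le m a b f x)
      map_add' := fun f g => by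
        ext x
        simp only [BoundedContinuousFunction.coe_ofNormedAddCommGroup,
          BoundedContinuousFunction.coe_add, Pi.add_apply, genFun, ← Finset.sum_add_distrib]
        refine Finset.sum_congr rfl fun i _ => ?_
        split_ifs <;> ring
      map_smul' := fun c f => by
        ext x
        simp only [BoundedContinuousFunction.coe_ofNormedAddCommGroup,
          BoundedContinuousFunction.coe_smul, smul_eq_mul, genFun, RingHom.id_apply,
          Finset.mul_sum]
        refine Finset.sum_congr rfl fun i _ => ?_
        split_ifs <;> ring }
    (∑ i, rateBound m a b i * 2)
    (fun f => BoundedContinuousFunction.norm_ofNormedAddCommGroup_le _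
      (mul_nonneg (Finset.sum_nonneg fun i _ => mul_nonneg
        (add_nonneg (Finset.sum_nonneg fun _ _ => abs_nonneg _)
          (Finset.sum_nonneg fun _ _ => abs_nonneg _)) zero_le_two) (norm_nonneg f))
      (fun x => abs_genFun_le m a b f x))

/-- The uniformly continuous semigroup `e^{tQ}` of a bounded operator `Q`. -/
def expSemigroup {E : Type*} [NormedAddCommGroup E] [NormedSpace ℝ E] (Q : E →L[ℝ] E) (t : ℝ) :
    E →L[ℝ] E :=
  NormedSpace.exp (t • Q)

/-- The transition semigroup `e^{tQ}` of the Markov chain with generator `Q`. -/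
def semigroup {N : ℕ} (m a b : Fin N → ℝ) (t : ℝ≥0) : (Config N →ᵇ ℝ) →L[ℝ] (Config N →ᵇ ℝ) :=
  expSemigroup (generator m a b) (t : ℝ)

/-- The `σ`-algebra generated by the process up to time `t`. -/
@[reducible] def past {N : ℕ} {Ω : Type*} (X : ℝ≥0 → Ω → Config N) (t : ℝ≥0) : MeasurableSpace Ω :=
  ⨆ s : Set.Iic t, MeasurableSpace.comap (X s) inferInstance

/-- `X` is the elastic particle system with masses `m`, intrinsic jump rates `a` (left) and `b`
(right), started from `x₀`: the right-continuous continuous-time Markov chain on the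
configuration space with initial state `x₀` and the jump rates encoded in `generator`. -/
structure IsElasticSystem {N : ℕ} {Ω : Type*} [MeasurableSpace Ω] (m a b : Fin N → ℝ)
    (x₀ : Config N) (X : ℝ≥0 → Ω → Config N) (P : Measure Ω) : Prop where
  measurable : ∀ t, Measurable (X t)
  initial : ∀ᵐ ω ∂P, X 0 ω = x₀
  rightContinuous : ∀ᵐ ω ∂P, ∀ t, ContinuousWithinAt (fun u => X u ω) (Set.Ici t) t
  markov : ∀ (s t : ℝ≥0), s ≤ t → ∀ f : Config N →ᵇ ℝ,
    P[fun ω => f (X t ω) | past X s] =ᵐ[P] fun ω => semigroup m a b (t - s) f (X s ω)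

/-- `M_k = ∑_{i=1}^k m_i`. -/
def M {N : ℕ} (m : Fin N → ℝ) (k : ℕ) : ℝ :=
  ∑ i : Fin N with i.val + 1 ≤ k, m i

/-- `U_k = - ∑_{i=1}^k m_i u_i`, with the intrinsic velocities `u_i = b_i - a_i`. -/
def U {N : ℕ} (m a b : Fin N → ℝ) (k : ℕ) : ℝ :=
  - ∑ i : Fin N with i.val + 1 ≤ k, m i * (b i - a i)

/-- `M_{ℓ,k} = M_k - M_ℓ`. -/
def Mdiff {N : ℕ} (m : Fin N → ℝ) (l k : ℕ) : ℝ := M m k - M m l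

/-- `U_{ℓ,k} = U_k - U_ℓ`. -/
def Udiff {N : ℕ} (m a b : Fin N → ℝ) (l k : ℕ) : ℝ := U m a b k - U m a b l

/-- The set of the particles with labels `l + 1, …, r`. -/
def block (N l r : ℕ) : Set (Fin N) := {i | l + 1 ≤ (i : ℕ) + 1 ∧ (i : ℕ) + 1 ≤ r}

/-- The span in the configuration `x` of the particles in the (non-empty) set `C`. -/
def span {N : ℕ} (C : Set (Fin N)) (x : Config N) : ℤ :=
  sSup (x.1 '' C) - sInf (x.1 '' C)

end Elastic

end

/-! The collision rule passes each particle's push to the bottom or top particle of its site, with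
momentum preserved. Hence the drift of the block's moment of inertia about its centre of mass `c`
has a first-order part at most that of free particles, `2 ∑ m_j (b_j - a_j) (x_j - c)`, plus a
bounded second-order term. Particles outside the block only help (`sum_left_force_le`,
`sum_right_force_le`): those sharing its end sites push inwards, and pushes handed on to them would
have been outward.

The choice of `c` makes a common velocity shift irrelevant. Shifting by `U_{ℓ,r}/M_{ℓ,r}` gives
weights of total zero, and the stability hypothesis says exactly that their proper partial sums are
positive. Summation by parts then bounds the force by `-ε` times the span (`exists_force_le`).

The gauge `√(1 + dispersion)` is comparable to the span and so drifts down at a rate bounded away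
from zero when it is large. For small `θ` the function `V = exp (θ * gauge)` absorbs the
second-order terms and satisfies `Q V ≤ -η V + η c` (`exists_lyapunov`). Expanding the semigroup in
powers of the positive operator `λ + Q` turns this into the time-uniform bound `V x₀ + c`
(`semigroup_le_of_genFun_le`), and Markov's inequality gives the exponential tail.

For the growth along paths, a visited state is kept for unit time with probability at least `exp
(-λ)`. The tail at one time therefore controls the whole preceding unit interval
(`measure_exists_Icc_le`), and Borel–Cantelli at level `(2/δ) log n` concludes. -/

noncomputable section

namespace Elastic

/-! ### Positivity of the generator and of its semigroup -/

/-- A bound for the total jump rate out of any configuration. -/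
def totalRate {N : ℕ} (m a b : Fin N → ℝ) : ℝ := ∑ i, rateBound m a b i

theorem totalRate_nonneg {N : ℕ} (m a b : Fin N → ℝ) : 0 ≤ totalRate m a b :=
  Finset.sum_nonneg fun _ _ => add_nonneg (Finset.sum_nonneg fun _ _ => abs_nonneg _)
    (Finset.sum_nonneg fun _ _ => abs_nonneg _)

theorem leftRate_nonneg {N : ℕ} {m a : Fin N → ℝ} (hm : ∀ i, 0 < m i) (ha : ∀ i, 0 ≤ a i)
    (x : Config N) (i : Fin N) : 0 ≤ leftRate m a x i := by
  refine Finset.sum_nonneg fun j _ => ?_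
  split_ifs
  · exact div_nonneg (mul_nonneg (hm j).le (ha j)) (hm i).le
  · exact le_rfl

theorem rightRate_nonneg {N : ℕ} {m b : Fin N → ℝ} (hm : ∀ i, 0 < m i) (hb : ∀ i, 0 ≤ b i)
    (x : Config N) (i : Fin N) : 0 ≤ rightRate m b x i := by
  refine Finset.sum_nonneg fun j _ => ?_
  split_ifs
  · exact div_nonneg (mul_nonneg (hm j).le (hb j)) (hm i).le
  · exact le_rfl

theorem genFun_sub {N : ℕ} (m a b : Fin N → ℝ) (f g : Config N → ℝ) (x : Config N) :
    genFun m a b (fun y => f y - g y) x = genFun m a b f x - genFun m a b g x := by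
  simp only [genFun, ← Finset.sum_sub_distrib]
  refine Finset.sum_congr rfl fun i _ => ?_
  split_ifs <;> ring

theorem genFun_affine {N : ℕ} (m a b : Fin N → ℝ) (f : Config N → ℝ) (p q : ℝ) (x : Config N) :
    genFun m a b (fun y => p * f y + q) x = p * genFun m a b f x := by
  simp only [genFun, Finset.mul_sum]
  refine Finset.sum_congr rfl fun i _ => ?_
  split_ifs <;> ring

/-- Inflow terms are nonnegative; only the outflow `-rate * f x` can be negative. -/
theorem neg_totalRate_mul_le_genFun {N : ℕ} {m a b : Fin N → ℝ} (hm : ∀ i, 0 < m i)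
    (ha : ∀ i, 0 ≤ a i) (hb : ∀ i, 0 ≤ b i) {f : Config N → ℝ} (hf : ∀ y, 0 ≤ f y)
    (x : Config N) : -(totalRate m a b * f x) ≤ genFun m a b f x := by
  rw [totalRate, Finset.sum_mul, ← Finset.sum_neg_distrib]
  refine Finset.sum_le_sum fun i _ => ?_
  have h1 := (le_abs_self _).trans (abs_leftRate_le m a x i)
  have h2 := (le_abs_self _).trans (abs_rightRate_le m b x i)
  have h3 := leftRate_nonneg hm ha x i
  have h4 := rightRate_nonneg hm hb x i
  rw [rateBound, add_mul, neg_add]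
  refine add_le_add ?_ ?_
  · split_ifs with h
    · nlinarith [mul_nonneg h3 (hf (jumpLeft x i h)), mul_le_mul_of_nonneg_right h1 (hf x)]
    · exact neg_nonpos.2 (mul_nonneg (h3.trans h1) (hf x))
  · split_ifs with h
    · nlinarith [mul_nonneg h4 (hf (jumpRight x i h)), mul_le_mul_of_nonneg_right h2 (hf x)]
    · exact neg_nonpos.2 (mul_nonneg (h4.trans h2) (hf x))

/-- Positivity of `λ + Q`, for arbitrary functions because the Lyapunov function is unbounded and
lies outside the domain of `generator`. -/
theorem mul_add_genFun_mono {N : ℕ} {m a b : Fin N → ℝ} (hm : ∀ i, 0 < m i)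
    (ha : ∀ i, 0 ≤ a i) (hb : ∀ i, 0 ≤ b i) {lam : ℝ} (hlam : totalRate m a b ≤ lam)
    {f g : Config N → ℝ} (hfg : ∀ y, f y ≤ g y) (x : Config N) :
    lam * f x + genFun m a b f x ≤ lam * g x + genFun m a b g x := by
  have h := neg_totalRate_mul_le_genFun (f := fun y => g y - f y) hm ha hb
    (fun y => sub_nonneg.2 (hfg y)) x
  rw [genFun_sub] at h
  have := mul_le_mul_of_nonneg_right hlam (sub_nonneg.2 (hfg x))
  linarith

/-- The operator `λ + Q`, which is positive once `λ` dominates all jump rates. -/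
def shiftedGenerator {N : ℕ} (m a b : Fin N → ℝ) (lam : ℝ) :
    (Config N →ᵇ ℝ) →L[ℝ] (Config N →ᵇ ℝ) :=
  lam • 1 + generator m a b

theorem shiftedGenerator_apply {N : ℕ} (m a b : Fin N → ℝ) (lam : ℝ) (f : Config N →ᵇ ℝ)
    (x : Config N) : shiftedGenerator m a b lam f x = lam * f x + genFun m a b f x := rfl

/-- Uniformization: split `t Q` as the scalar `-λ t` plus `t (λ + Q)`, which commute. For the chain
and large `λ` all terms of the series are positive operators. -/
theorem hasSum_expSemigroup {E : Type*} [NormedAddCommGroup E] [NormedSpace ℝ E] [CompleteSpace E]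
    (Q : E →L[ℝ] E) (lam t : ℝ) :
    HasSum (fun n : ℕ => Real.exp (-(lam * t)) • (t ^ n / n.factorial) • (lam • 1 + Q) ^ n)
      (expSemigroup Q t) := by
  let _ : NormedAlgebra ℚ (E →L[ℝ] E) := NormedAlgebra.restrictScalars ℚ ℝ _
  have hdec : t • Q = algebraMap ℝ (E →L[ℝ] E) (-(lam * t)) + t • (lam • 1 + Q) := by
    rw [Algebra.algebraMap_eq_smul_one]
    module
  rw [expSemigroup, hdec, NormedSpace.exp_add_of_commute (Algebra.commutes _ _),
    ← NormedSpace.algebraMap_exp_comm, ← Real.exp_eq_exp_ℝ, Algebra.algebraMap_eq_smul_one,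
    smul_mul_assoc, one_mul]
  refine HasSum.const_smul _ ?_
  have hs := NormedSpace.exp_series_hasSum_exp' (𝕂 := ℝ) (t • (lam • 1 + Q))
  refine hs.congr_fun fun n => ?_
  rw [smul_pow, smul_smul, div_eq_inv_mul]

theorem hasSum_semigroup {N : ℕ} (m a b : Fin N → ℝ) (lam : ℝ) (t : ℝ≥0) (f : Config N →ᵇ ℝ)
    (x : Config N) :
    HasSum (fun n : ℕ => Real.exp (-(lam * t)) *
      ((t : ℝ) ^ n / n.factorial * (shiftedGenerator m a b lam ^ n) f x))
      (semigroup m a b t f x) :=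
  ((hasSum_expSemigroup (generator m a b) lam t).mapL
    (ContinuousLinearMap.apply ℝ _ f)).mapL (BoundedContinuousFunction.evalCLM ℝ x)

theorem hasSum_exp_neg_mul (lam t : ℝ) :
    HasSum (fun n : ℕ => Real.exp (-(lam * t)) * (t ^ n / n.factorial * lam ^ n)) 1 := by
  have h := (NormedSpace.expSeries_div_hasSum_exp (lam * t)).mul_left (Real.exp (-(lam * t)))
  rw [← Real.exp_eq_exp_ℝ, ← Real.exp_add, neg_add_cancel, Real.exp_zero] at h
  refine h.congr_fun fun n => ?_
  rw [mul_pow]; ring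

theorem shiftedGenerator_pow_nonneg {N : ℕ} {m a b : Fin N → ℝ} (hm : ∀ i, 0 < m i)
    (ha : ∀ i, 0 ≤ a i) (hb : ∀ i, 0 ≤ b i) {lam : ℝ} (hlam : totalRate m a b ≤ lam)
    {f : Config N →ᵇ ℝ} (hf : ∀ y, 0 ≤ f y) (n : ℕ) (x : Config N) :
    0 ≤ (shiftedGenerator m a b lam ^ n) f x := by
  induction n generalizing x with
  | zero => simpa using hf x
  | succ n ih =>
    rw [pow_succ', mul_apply_eq_comp, shiftedGenerator_apply]
    have h := mul_add_genFun_mono hm ha hb hlam (f := fun _ => 0) ih x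
    have h0 : genFun m a b (fun _ => 0) x = 0 := by simp [genFun]
    simpa [h0] using h

/-- The chain stays put up to time `t` with probability at least `exp (-λ t)`. -/
theorem exp_mul_le_semigroup {N : ℕ} {m a b : Fin N → ℝ} (hm : ∀ i, 0 < m i)
    (ha : ∀ i, 0 ≤ a i) (hb : ∀ i, 0 ≤ b i) {lam : ℝ} (hlam : totalRate m a b ≤ lam)
    {f : Config N →ᵇ ℝ} (hf : ∀ y, 0 ≤ f y) (t : ℝ≥0) (x : Config N) :
    Real.exp (-(lam * t)) * f x ≤ semigroup m a b t f x := by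
  -- Only the term `n = 0` of the nonnegative series is kept.
  have h := le_hasSum (hasSum_semigroup m a b lam t f x) 0 fun n _ =>
    mul_nonneg (Real.exp_nonneg _) (mul_nonneg (by positivity)
      (shiftedGenerator_pow_nonneg hm ha hb hlam hf n x))
  simpa using h

/-- The drift condition reads `(λ + Q) V ≤ (λ - η) V + η c`, and the right-hand side is the result
of iterating it. Only a bounded minorant `f` of `V` is fed to the operator. -/
theorem shiftedGenerator_pow_le {N : ℕ} {m a b : Fin N → ℝ} (hm : ∀ i, 0 < m i)
    (ha : ∀ i, 0 ≤ a i) (hb : ∀ i, 0 ≤ b i) {lam : ℝ} (hlam : totalRate m a b ≤ lam)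
    {V : Config N → ℝ} {η c : ℝ} (hηlam : η ≤ lam)
    (hLV : ∀ x, genFun m a b V x ≤ -η * V x + η * c) {f : Config N →ᵇ ℝ}
    (hf : ∀ y, f y ≤ V y) (n : ℕ) (x : Config N) :
    (shiftedGenerator m a b lam ^ n) f x
      ≤ (lam - η) ^ n * V x + (lam ^ n - (lam - η) ^ n) * c := by
  induction n generalizing x with
  | zero => simpa using hf x
  | succ n ih =>
    rw [pow_succ', mul_apply_eq_comp, shiftedGenerator_apply]
    refine (mul_add_genFun_mono hm ha hb hlam ih x).trans ?_
    rw [genFun_affine]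
    have h := mul_le_mul_of_nonneg_left (hLV x) (pow_nonneg (sub_nonneg.2 hηlam) n)
    rw [pow_succ' (lam - η), pow_succ' lam]
    linarith

/-- Foster–Lyapunov bound for the semigroup. -/
theorem semigroup_le_of_genFun_le {N : ℕ} {m a b : Fin N → ℝ} (hm : ∀ i, 0 < m i)
    (ha : ∀ i, 0 ≤ a i) (hb : ∀ i, 0 ≤ b i) {V : Config N → ℝ} (hV : ∀ x, 0 ≤ V x)
    {η c : ℝ} (hη : 0 ≤ η) (hc : 0 ≤ c)
    (hLV : ∀ x, genFun m a b V x ≤ -η * V x + η * c) {f : Config N →ᵇ ℝ}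
    (hf : ∀ y, f y ≤ V y) (t : ℝ≥0) (x : Config N) :
    semigroup m a b t f x ≤ V x + c := by
  -- This `λ` serves two purposes: `λ + Q` is positive, and `λ - η` is nonnegative.
  have hlam : totalRate m a b ≤ totalRate m a b + η := by linarith
  have hηlam : η ≤ totalRate m a b + η := by linarith [totalRate_nonneg m a b]
  set lam := totalRate m a b + η with hlamdef
  have h1 := (hasSum_exp_neg_mul lam t).mul_right (V x + c)
  rw [one_mul] at h1
  refine hasSum_le (fun n => ?_) (hasSum_semigroup m a b lam t f x) h1
  rw [mul_assoc, mul_assoc]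
  refine mul_le_mul_of_nonneg_left (mul_le_mul_of_nonneg_left ?_ (by positivity))
    (Real.exp_nonneg _)
  refine (shiftedGenerator_pow_le hm ha hb hlam hηlam hLV hf n x).trans ?_
  have hp : (lam - η) ^ n ≤ lam ^ n :=
    pow_le_pow_left₀ (sub_nonneg.2 hηlam) (by linarith) n
  have hp0 : 0 ≤ (lam - η) ^ n := pow_nonneg (sub_nonneg.2 hηlam) n
  nlinarith [mul_le_mul_of_nonneg_right hp (hV x), mul_nonneg hp0 hc]

/-! ### Blocks of particles -/

/-- The particles with labels `l + 1, …, r` as a finite set. -/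
def blockFinset (N l r : ℕ) : Finset (Fin N) := {i | l ≤ (i : ℕ) ∧ (i : ℕ) < r}

theorem mem_blockFinset {N l r : ℕ} {i : Fin N} :
    i ∈ blockFinset N l r ↔ l ≤ (i : ℕ) ∧ (i : ℕ) < r := by
  simp [blockFinset]

theorem sum_blockFinset_self {N : ℕ} (f : Fin N → ℝ) (l : ℕ) :
    ∑ i ∈ blockFinset N l l, f i = 0 := by
  rw [Finset.sum_eq_zero]
  intro i hi
  rw [mem_blockFinset] at hi
  omega

theorem sum_blockFinset_succ {N : ℕ} (f : Fin N → ℝ) {l k : ℕ} (hlk : l ≤ k) (hk : k < N) :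
    ∑ i ∈ blockFinset N l (k + 1), f i = ∑ i ∈ blockFinset N l k, f i + f ⟨k, hk⟩ := by
  have h : blockFinset N l (k + 1) = insert ⟨k, hk⟩ (blockFinset N l k) := by
    ext i
    simp only [mem_blockFinset, Finset.mem_insert, Fin.ext_iff]
    omega
  rw [h, Finset.sum_insert (by simp [mem_blockFinset]), add_comm]

theorem sum_filter_sub_eq_sum_blockFinset {N : ℕ} (f : Fin N → ℝ) {l k : ℕ} (hlk : l ≤ k) :
    (∑ i : Fin N with i.val + 1 ≤ k, f i) - ∑ i : Fin N with i.val + 1 ≤ l, f i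
      = ∑ i ∈ blockFinset N l k, f i := by
  have h : (Finset.univ.filter fun i : Fin N => i.val + 1 ≤ k)
      = (Finset.univ.filter fun i : Fin N => i.val + 1 ≤ l) ∪ blockFinset N l k := by
    ext i
    simp only [mem_blockFinset, Finset.mem_union, Finset.mem_filter, Finset.mem_univ, true_and]
    omega
  rw [h, Finset.sum_union, add_sub_cancel_left]
  rw [Finset.disjoint_left]
  intro i hi
  simp only [mem_blockFinset, Finset.mem_filter, Finset.mem_univ, true_and] at hi ⊢
  omega

theorem Mdiff_eq_sum {N : ℕ} (m : Fin N → ℝ) {l k : ℕ} (hlk : l ≤ k) :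
    Mdiff m l k = ∑ i ∈ blockFinset N l k, m i :=
  sum_filter_sub_eq_sum_blockFinset m hlk

theorem Udiff_eq_sum {N : ℕ} (m a b : Fin N → ℝ) {l k : ℕ} (hlk : l ≤ k) :
    Udiff m a b l k = -∑ i ∈ blockFinset N l k, m i * (b i - a i) := by
  rw [← sum_filter_sub_eq_sum_blockFinset _ hlk, Udiff, U, U]
  ring

theorem sum_blockFinset_pos {N : ℕ} {m : Fin N → ℝ} (hm : ∀ i, 0 < m i) {l k : ℕ} (hlk : l < k)
    (hkN : k ≤ N) : 0 < ∑ i ∈ blockFinset N l k, m i :=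
  Finset.sum_pos (fun i _ => hm i) ⟨⟨l, by omega⟩, mem_blockFinset.2 ⟨le_rfl, hlk⟩⟩

/-- Summation by parts against weights whose proper partial sums are at least `ε`. -/
theorem sum_mul_le_of_le_partialSum {N : ℕ} (w y : Fin N → ℝ) (hy : Monotone y) {l r : ℕ} {ε : ℝ}
    (hlN : l < N) (hS : ∀ k, l < k → k < r → ε ≤ ∑ i ∈ blockFinset N l k, w i)
    (k : ℕ) (hk : l ≤ k) (hkr : k < r) (hkN : k < N) :
    ∑ i ∈ blockFinset N l (k + 1), w i * y i
      ≤ (∑ i ∈ blockFinset N l (k + 1), w i) * y ⟨k, hkN⟩ - ε * (y ⟨k, hkN⟩ - y ⟨l, hlN⟩) := by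
  induction k, hk using Nat.le_induction with
  | base =>
    rw [sum_blockFinset_succ _ le_rfl hlN, sum_blockFinset_succ _ le_rfl hlN,
      sum_blockFinset_self, sum_blockFinset_self]
    simp
  | succ k hk ih =>
    have hkN' : k < N := by omega
    have ih := ih (by omega) hkN'
    have h1 := hS (k + 1) (by omega) hkr
    have h2 : y ⟨k, hkN'⟩ ≤ y ⟨k + 1, hkN⟩ := hy (by
      change k ≤ k + 1
      omega)
    rw [sum_blockFinset_succ _ (by omega : l ≤ k + 1) hkN,
      sum_blockFinset_succ w (by omega : l ≤ k + 1) hkN]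
    -- Passing to the next particle adds the new gap times the current partial sum minus `ε`, which
    -- is nonnegative.
    nlinarith [mul_le_mul_of_nonneg_right h1 (sub_nonneg.2 h2)]

theorem span_block_eq {N l r : ℕ} (x : Config N) {f e : Fin N} (hf : (f : ℕ) = l)
    (he : (e : ℕ) + 1 = r) (hlr : l < r) :
    span (block N l r) x = x.1 e - x.1 f := by
  have hgr : IsGreatest (x.1 '' block N l r) (x.1 e) := by
    refine ⟨⟨e, ⟨by omega, by omega⟩, rfl⟩, ?_⟩
    rintro _ ⟨i, ⟨_, hi⟩, rfl⟩
    exact x.2 (show (i : ℕ) ≤ e by omega)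
  have hle : IsLeast (x.1 '' block N l r) (x.1 f) := by
    refine ⟨⟨f, ⟨by omega, by omega⟩, rfl⟩, ?_⟩
    rintro _ ⟨i, ⟨hi, _⟩, rfl⟩
    exact x.2 (show (f : ℕ) ≤ i by omega)
  rw [span, hgr.csSup_eq, hle.csInf_eq]

/-! ### Sites and their extreme particles -/

/-- The carrier `p` of the leftward push of `j` is unique, so a sum over `i` of the indicator of
this condition has exactly one term. -/
theorem exists_bottom {N : ℕ} (x : Config N) (j : Fin N) :
    ∃ p : Fin N, ∀ i, (IsBottom x i ∧ i ≤ j ∧ x.1 j = x.1 i) ↔ i = p := by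
  let s : Finset (Fin N) := {i | x.1 j = x.1 i}
  have hs : s.Nonempty := ⟨j, by simp [s]⟩
  have hmem : ∀ i, i ∈ s ↔ x.1 j = x.1 i := fun i => by simp [s]
  refine ⟨s.min' hs, fun i => ⟨?_, ?_⟩⟩
  · rintro ⟨hb, hij, hx⟩
    refine le_antisymm ?_ (s.min'_le _ ((hmem i).2 hx))
    by_contra hlt
    rw [not_le] at hlt
    have hpx := (hmem _).1 (s.min'_mem hs)
    have hlt' : ((s.min' hs : Fin N) : ℕ) < i := hlt
    have h1 := hb ⟨(i : ℕ) - 1, by omega⟩ (by simp only; omega)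
    have h2 : x.1 (s.min' hs) ≤ x.1 ⟨(i : ℕ) - 1, by omega⟩ := x.2 (by
      change ((s.min' hs : Fin N) : ℕ) ≤ (i : ℕ) - 1
      omega)
    omega
  · rintro rfl
    have hpx := (hmem _).1 (s.min'_mem hs)
    refine ⟨fun k hk => ?_, s.min'_le _ ((hmem j).2 rfl), hpx⟩
    have hle : x.1 k ≤ x.1 (s.min' hs) := x.2 (by
      change (k : ℕ) ≤ (s.min' hs : Fin N)
      omega)
    refine lt_of_le_of_ne hle fun he => ?_
    have h3 : ((s.min' hs : Fin N) : ℕ) ≤ k := s.min'_le k ((hmem k).2 (hpx.trans he.symm))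
    omega

theorem exists_top {N : ℕ} (x : Config N) (j : Fin N) :
    ∃ p : Fin N, ∀ i, (IsTop x i ∧ j ≤ i ∧ x.1 j = x.1 i) ↔ i = p := by
  let s : Finset (Fin N) := {i | x.1 j = x.1 i}
  have hs : s.Nonempty := ⟨j, by simp [s]⟩
  have hmem : ∀ i, i ∈ s ↔ x.1 j = x.1 i := fun i => by simp [s]
  refine ⟨s.max' hs, fun i => ⟨?_, ?_⟩⟩
  · rintro ⟨hb, hij, hx⟩
    refine le_antisymm (s.le_max' _ ((hmem i).2 hx)) ?_
    by_contra hlt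
    rw [not_le] at hlt
    have hpx := (hmem _).1 (s.max'_mem hs)
    have hlt' : (i : ℕ) < (s.max' hs : Fin N) := hlt
    have hN := (s.max' hs).2
    have h1 := hb ⟨(i : ℕ) + 1, by omega⟩ (by simp only)
    have h2 : x.1 ⟨(i : ℕ) + 1, by omega⟩ ≤ x.1 (s.max' hs) := x.2 (by
      change (i : ℕ) + 1 ≤ (s.max' hs : Fin N)
      omega)
    omega
  · rintro rfl
    have hpx := (hmem _).1 (s.max'_mem hs)
    refine ⟨fun k hk => ?_, s.le_max' _ ((hmem j).2 rfl), hpx⟩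
    have hle : x.1 (s.max' hs) ≤ x.1 k := x.2 (by
      change ((s.max' hs : Fin N) : ℕ) ≤ k
      omega)
    refine lt_of_le_of_ne hle fun he => ?_
    have h3 : (k : ℕ) ≤ (s.max' hs : Fin N) := s.le_max' k ((hmem k).2 (hpx.trans he))
    omega

open Classical in
/-- The particles outside the block can only decrease the leftward force on the block as measured
relative to a point `c` between its endpoints. -/
theorem sum_left_force_le {N : ℕ} {m a : Fin N → ℝ} (hm : ∀ i, 0 < m i) (ha : ∀ i, 0 ≤ a i)
    {l r : ℕ} {f e : Fin N} (hf : (f : ℕ) = l) (he : (e : ℕ) + 1 = r) (x : Config N) {c : ℝ}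
    (hfc : (x.1 f : ℝ) ≤ c) (hce : c ≤ x.1 e) :
    ∑ i ∈ blockFinset N l r,
        (if IsBottom x i then leftRate m a x i * (m i * (c - x.1 i)) else 0)
      ≤ ∑ j ∈ blockFinset N l r, m j * a j * (c - x.1 j) := by
  -- Regroup by the particle `j` that exerts the push rather than the particle `i` that moves; the
  -- mass of `i` cancels.
  have hswap : ∑ i ∈ blockFinset N l r,
        (if IsBottom x i then leftRate m a x i * (m i * (c - x.1 i)) else 0)
      = ∑ j, m j * a j * ∑ i ∈ blockFinset N l r,
        if IsBottom x i ∧ i ≤ j ∧ x.1 j = x.1 i then c - x.1 j else 0 := by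
    simp only [Finset.mul_sum]
    rw [Finset.sum_comm]
    refine Finset.sum_congr rfl fun i _ => ?_
    by_cases hb : IsBottom x i
    · rw [if_pos hb, leftRate, Finset.sum_mul]
      refine Finset.sum_congr rfl fun j _ => ?_
      by_cases hj : i ≤ j ∧ x.1 j = x.1 i
      · rw [if_pos hj, if_pos ⟨hb, hj⟩, hj.2]
        have := (hm i).ne'
        field_simp
      · rw [if_neg hj, if_neg fun h => hj h.2, zero_mul, mul_zero]
    · simp [hb]
  have hR : ∑ j ∈ blockFinset N l r, m j * a j * (c - x.1 j)
      = ∑ j, m j * a j * if j ∈ blockFinset N l r then c - x.1 j else 0 := by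
    simp only [mul_ite, mul_zero, Finset.sum_ite_mem, Finset.univ_inter]
  rw [hswap, hR]
  refine Finset.sum_le_sum fun j _ => mul_le_mul_of_nonneg_left ?_ (mul_nonneg (hm j).le (ha j))
  obtain ⟨p, hp⟩ := exists_bottom x j
  simp only [hp, Finset.sum_ite_eq']
  obtain ⟨-, hpj, hpx⟩ := (hp p).2 rfl
  have hpj' : (p : ℕ) ≤ j := hpj
  -- If only the carrier `p` is in the block, then `j` lies to its right, so `x_j ≥ x_e ≥ c` and the
  -- extra term is nonpositive. If only `j` is in the block, then `x_j = x_p ≤ x_f ≤ c` and the lost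
  -- term was nonnegative.
  by_cases hpB : p ∈ blockFinset N l r <;> by_cases hjB : j ∈ blockFinset N l r
  · simp [hpB, hjB]
  · rw [if_pos hpB, if_neg hjB]
    rw [mem_blockFinset] at hpB hjB
    have h1 : x.1 e ≤ x.1 j := x.2 (show (e : ℕ) ≤ j by omega)
    have h2 : (x.1 e : ℝ) ≤ x.1 j := by exact_mod_cast h1
    linarith
  · rw [if_neg hpB, if_pos hjB]
    rw [mem_blockFinset] at hpB hjB
    have h1 : x.1 p ≤ x.1 f := x.2 (show (p : ℕ) ≤ f by omega)
    have h2 : (x.1 j : ℝ) ≤ x.1 f := by rw [hpx]; exact_mod_cast h1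
    linarith
  · simp [hpB, hjB]

open Classical in
/-- The mirror image of `sum_left_force_le` for jumps to the right. -/
theorem sum_right_force_le {N : ℕ} {m b : Fin N → ℝ} (hm : ∀ i, 0 < m i) (hb : ∀ i, 0 ≤ b i)
    {l r : ℕ} {f e : Fin N} (hf : (f : ℕ) = l) (he : (e : ℕ) + 1 = r) (x : Config N) {c : ℝ}
    (hfc : (x.1 f : ℝ) ≤ c) (hce : c ≤ x.1 e) :
    ∑ i ∈ blockFinset N l r,
        (if IsTop x i then rightRate m b x i * (m i * (x.1 i - c)) else 0)
      ≤ ∑ j ∈ blockFinset N l r, m j * b j * (x.1 j - c) := by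
  have hswap : ∑ i ∈ blockFinset N l r,
        (if IsTop x i then rightRate m b x i * (m i * (x.1 i - c)) else 0)
      = ∑ j, m j * b j * ∑ i ∈ blockFinset N l r,
        if IsTop x i ∧ j ≤ i ∧ x.1 j = x.1 i then x.1 j - c else 0 := by
    simp only [Finset.mul_sum]
    rw [Finset.sum_comm]
    refine Finset.sum_congr rfl fun i _ => ?_
    by_cases hb : IsTop x i
    · rw [if_pos hb, rightRate, Finset.sum_mul]
      refine Finset.sum_congr rfl fun j _ => ?_
      by_cases hj : j ≤ i ∧ x.1 j = x.1 i
      · rw [if_pos hj, if_pos ⟨hb, hj⟩, hj.2]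
        have := (hm i).ne'
        field_simp
      · rw [if_neg hj, if_neg fun h => hj h.2, zero_mul, mul_zero]
    · simp [hb]
  have hR : ∑ j ∈ blockFinset N l r, m j * b j * (x.1 j - c)
      = ∑ j, m j * b j * if j ∈ blockFinset N l r then x.1 j - c else 0 := by
    simp only [mul_ite, mul_zero, Finset.sum_ite_mem, Finset.univ_inter]
  rw [hswap, hR]
  refine Finset.sum_le_sum fun j _ => mul_le_mul_of_nonneg_left ?_ (mul_nonneg (hm j).le (hb j))
  obtain ⟨p, hp⟩ := exists_top x j
  simp only [hp, Finset.sum_ite_eq']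
  obtain ⟨-, hpj, hpx⟩ := (hp p).2 rfl
  have hpj' : (j : ℕ) ≤ p := hpj
  by_cases hpB : p ∈ blockFinset N l r <;> by_cases hjB : j ∈ blockFinset N l r
  · simp [hpB, hjB]
  · rw [if_pos hpB, if_neg hjB]
    rw [mem_blockFinset] at hpB hjB
    have h1 : x.1 j ≤ x.1 f := x.2 (show (j : ℕ) ≤ f by omega)
    have h2 : (x.1 j : ℝ) ≤ x.1 f := by exact_mod_cast h1
    linarith
  · rw [if_neg hpB, if_pos hjB]
    rw [mem_blockFinset] at hpB hjB
    have h1 : x.1 e ≤ x.1 p := x.2 (show (e : ℕ) ≤ p by omega)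
    have h2 : (x.1 e : ℝ) ≤ x.1 j := by rw [hpx]; exact_mod_cast h1
    linarith
  · simp [hpB, hjB]

/-! ### Dispersion around the centre of mass -/

/-- The centre of mass of the particles in `B`. -/
def centre {ι : Type*} (m : ι → ℝ) (B : Finset ι) (y : ι → ℝ) : ℝ :=
  (∑ i ∈ B, m i * y i) / ∑ i ∈ B, m i

/-- The moment of inertia of the particles in `B` about their centre of mass. -/
def dispersion {ι : Type*} (m : ι → ℝ) (B : Finset ι) (y : ι → ℝ) : ℝ :=
  ∑ i ∈ B, m i * (y i - centre m B y) ^ 2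

section Dispersion

variable {ι : Type*} {m : ι → ℝ} {B : Finset ι}

theorem dispersion_nonneg (hm : ∀ i, 0 < m i) (y : ι → ℝ) : 0 ≤ dispersion m B y :=
  Finset.sum_nonneg fun i _ => mul_nonneg (hm i).le (sq_nonneg _)

theorem sum_mul_sub_centre (hB : 0 < ∑ i ∈ B, m i) (y : ι → ℝ) :
    ∑ i ∈ B, m i * (y i - centre m B y) = 0 := by
  simp only [mul_sub, Finset.sum_sub_distrib, ← Finset.sum_mul, centre]
  field_simp
  ring

theorem dispersion_eq (hB : 0 < ∑ i ∈ B, m i) (y : ι → ℝ) :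
    dispersion m B y = ∑ i ∈ B, m i * y i ^ 2 - (∑ i ∈ B, m i * y i) ^ 2 / ∑ i ∈ B, m i := by
  have h : ∀ i, m i * (y i - centre m B y) ^ 2
      = m i * y i ^ 2 - 2 * centre m B y * (m i * y i) + centre m B y ^ 2 * m i :=
    fun i => by ring
  simp only [dispersion, h, Finset.sum_add_distrib, Finset.sum_sub_distrib, ← Finset.mul_sum]
  rw [centre]
  field_simp
  ring

/-- The linear term is the force felt by `i`; the quadratic coefficient is reduced by the motion of
the centre itself and stays between `0` and `m i`. -/
theorem dispersion_add [DecidableEq ι] (hB : 0 < ∑ i ∈ B, m i) (y : ι → ℝ) {i : ι} (hi : i ∈ B)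
    (σ : ℝ) :
    dispersion m B (fun j => y j + if j = i then σ else 0)
      = dispersion m B y + 2 * (m i * (σ * (y i - centre m B y)))
        + σ ^ 2 * (m i - m i ^ 2 / ∑ i ∈ B, m i) := by
  rw [dispersion_eq hB, dispersion_eq hB, centre]
  have h1 : ∑ j ∈ B, m j * (y j + if j = i then σ else 0)
      = ∑ j ∈ B, m j * y j + m i * σ := by
    simp [mul_add, Finset.sum_add_distrib, hi]
  have h2 : ∑ j ∈ B, m j * (y j + if j = i then σ else 0) ^ 2
      = ∑ j ∈ B, m j * y j ^ 2 + m i * (2 * σ * y i + σ ^ 2) := by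
    have h : ∀ j, m j * (y j + if j = i then σ else 0) ^ 2
        = m j * y j ^ 2 + if j = i then m j * (2 * σ * y j + σ ^ 2) else 0 := fun j => by
      split_ifs <;> ring
    simp [h, Finset.sum_add_distrib, hi]
  rw [h1, h2]
  field_simp
  ring

theorem mul_sq_sub_centre_le_dispersion (hm : ∀ i, 0 < m i) (y : ι → ℝ) {i : ι} (hi : i ∈ B) :
    m i * (y i - centre m B y) ^ 2 ≤ dispersion m B y :=
  Finset.single_le_sum (f := fun i => m i * (y i - centre m B y) ^ 2)
    (fun i _ => mul_nonneg (hm i).le (sq_nonneg _)) hi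

theorem centre_mem_Icc (hm : ∀ i, 0 < m i) (hB : 0 < ∑ i ∈ B, m i) {y : ι → ℝ} {u v : ℝ}
    (hu : ∀ i ∈ B, u ≤ y i) (hv : ∀ i ∈ B, y i ≤ v) : centre m B y ∈ Set.Icc u v := by
  rw [centre, Set.mem_Icc, le_div_iff₀ hB, div_le_iff₀ hB, Finset.mul_sum, Finset.mul_sum]
  constructor <;> refine Finset.sum_le_sum fun i hi => ?_
  · nlinarith [mul_le_mul_of_nonneg_left (hu i hi) (hm i).le]
  · nlinarith [mul_le_mul_of_nonneg_left (hv i hi) (hm i).le]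

theorem dispersion_le (hm : ∀ i, 0 < m i) (hB : 0 < ∑ i ∈ B, m i) {y : ι → ℝ} {u v : ℝ}
    (hu : ∀ i ∈ B, u ≤ y i) (hv : ∀ i ∈ B, y i ≤ v) :
    dispersion m B y ≤ (∑ i ∈ B, m i) * (v - u) ^ 2 := by
  have hc := centre_mem_Icc hm hB hu hv
  rw [dispersion, Finset.sum_mul]
  refine Finset.sum_le_sum fun i hi => mul_le_mul_of_nonneg_left ?_ (hm i).le
  exact sq_le_sq' (by linarith [hu i hi, hc.2]) (by linarith [hv i hi, hc.1])

/-- A smoothed square root of the dispersion. -/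
def gauge (m : ι → ℝ) (B : Finset ι) (y : ι → ℝ) : ℝ := √(1 + dispersion m B y)

theorem gauge_sq (hm : ∀ i, 0 < m i) (y : ι → ℝ) : gauge m B y ^ 2 = 1 + dispersion m B y :=
  Real.sq_sqrt (by linarith [dispersion_nonneg (B := B) hm y])

theorem one_le_gauge (hm : ∀ i, 0 < m i) (y : ι → ℝ) : 1 ≤ gauge m B y :=
  Real.one_le_sqrt.2 (by linarith [dispersion_nonneg (B := B) hm y])

/-- One half of the comparison between gauge and span; `abs_sub_centre_le`, applied at both end
particles, gives the other. -/
theorem gauge_le (hm : ∀ i, 0 < m i) (hB : 0 < ∑ i ∈ B, m i) {y : ι → ℝ} {u v : ℝ} (huv : u ≤ v)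
    (hu : ∀ i ∈ B, u ≤ y i) (hv : ∀ i ∈ B, y i ≤ v) :
    gauge m B y ≤ (1 + ∑ i ∈ B, m i) * (1 + (v - u)) := by
  have h := dispersion_le hm hB hu hv
  set μ := ∑ i ∈ B, m i
  have hd : 0 ≤ v - u := sub_nonneg.2 huv
  refine Real.sqrt_le_iff.2 ⟨by positivity, ?_⟩
  nlinarith [mul_nonneg hB.le hd, mul_nonneg hB.le (sq_nonneg (v - u)), sq_nonneg (μ * (v - u)),
    mul_nonneg (mul_nonneg hB.le hB.le) hd, sq_nonneg μ, sq_nonneg (v - u)]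

theorem abs_sub_centre_le (hm : ∀ i, 0 < m i) (y : ι → ℝ) {i : ι} (hi : i ∈ B) :
    |y i - centre m B y| ≤ (√(m i))⁻¹ * gauge m B y := by
  have h := mul_sq_sub_centre_le_dispersion hm y hi
  have hs : 0 < √(m i) := Real.sqrt_pos.2 (hm i)
  rw [inv_mul_eq_div, le_div_iff₀ hs]
  refine Real.le_sqrt_of_sq_le ?_
  rw [mul_pow, sq_abs, Real.sq_sqrt (hm i).le]
  linarith

end Dispersion

/-- Second order expansion of `d ↦ exp (θ √(1 + d))`. -/
theorem exp_mul_sub_exp_mul_le {g g' d d' κ θ : ℝ} (hg : 1 ≤ g) (hg' : 1 ≤ g')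
    (hgd : g ^ 2 = 1 + d) (hgd' : g' ^ 2 = 1 + d') (hκ : |d' - d| ≤ κ * g) (hθ : 0 ≤ θ)
    (hθκ : θ * κ ≤ 1) :
    Real.exp (θ * g') - Real.exp (θ * g)
      ≤ Real.exp (θ * g) * (θ / (2 * g) * (d' - d) + θ ^ 2 * κ ^ 2) := by
  have hg0 : 0 < g := by linarith
  have hκ0 : 0 ≤ κ := by
    by_contra h
    nlinarith [abs_nonneg (d' - d)]
  -- Concavity of the square root: it lies below its tangent.
  have h1 : g' - g ≤ (d' - d) / (2 * g) := by
    rw [le_div_iff₀ (by positivity)]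
    nlinarith [sq_nonneg (g' - g)]
  have h2 : |g' - g| ≤ κ := by
    have : |g' - g| * (g' + g) = |d' - d| := by
      rw [← abs_of_pos (show 0 < g' + g by linarith), ← abs_mul]
      congr 1
      nlinarith
    nlinarith [abs_nonneg (g' - g)]
  have h3 : |θ * (g' - g)| ≤ θ * κ := by
    rw [abs_mul, abs_of_nonneg hθ]
    exact mul_le_mul_of_nonneg_left h2 hθ
  -- `exp u ≤ 1 + u + u ^ 2` for `|u| ≤ 1`, which is why `θ * κ ≤ 1` is assumed.
  have h4 := (abs_le.1 (Real.abs_exp_sub_one_sub_id_le (h3.trans hθκ))).2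
  have h5 : (θ * (g' - g)) ^ 2 ≤ θ ^ 2 * κ ^ 2 := by
    rw [← mul_pow, ← sq_abs]
    exact pow_le_pow_left₀ (abs_nonneg _) h3 2
  have h6 : Real.exp (θ * g') = Real.exp (θ * g) * Real.exp (θ * (g' - g)) := by
    rw [← Real.exp_add]; ring_nf
  rw [h6, ← mul_sub_one]
  refine mul_le_mul_of_nonneg_left ?_ (Real.exp_nonneg _)
  have h7 := mul_le_mul_of_nonneg_left h1 hθ
  have h8 : θ * ((d' - d) / (2 * g)) = θ / (2 * g) * (d' - d) := by ring
  linarith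

/-- The effect of one unit jump on the exponential of the gauge. -/
theorem exp_gauge_add_sub_le {ι : Type*} [DecidableEq ι] {m : ι → ℝ} {B : Finset ι}
    (hm : ∀ i, 0 < m i) (hB : 0 < ∑ i ∈ B, m i) (y : ι → ℝ) {i : ι} (hi : i ∈ B) {σ θ : ℝ}
    (hσ : σ ^ 2 = 1) (hθ : 0 ≤ θ) (hθκ : θ * (3 * (1 + ∑ i ∈ B, m i)) ≤ 1) :
    Real.exp (θ * gauge m B (fun j => y j + if j = i then σ else 0))
        - Real.exp (θ * gauge m B y)
      ≤ Real.exp (θ * gauge m B y) * (θ / (2 * gauge m B y)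
          * (2 * (m i * (σ * (y i - centre m B y))) + ∑ i ∈ B, m i)
          + θ ^ 2 * (3 * (1 + ∑ i ∈ B, m i)) ^ 2) := by
  have hd := dispersion_add hB y hi σ
  rw [hσ, one_mul] at hd
  set y' := fun j => y j + if j = i then σ else 0
  set μ := ∑ i ∈ B, m i
  set g := gauge m B y with hgdef
  have hg : 1 ≤ g := one_le_gauge hm y
  have hmi : m i ≤ μ := Finset.single_le_sum (fun i _ => (hm i).le) hi
  have hmi0 := hm i
  have hq0 : 0 ≤ m i ^ 2 / μ := by positivity
  have hq1 : m i ^ 2 / μ ≤ m i := by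
    rw [div_le_iff₀ hB]; nlinarith
  have hz : |m i * (σ * (y i - centre m B y))| ≤ (1 + μ) * g := by
    refine abs_le_of_sq_le_sq ?_ (by positivity)
    have h1 := mul_sq_sub_centre_le_dispersion hm y hi
    have h2 := gauge_sq (B := B) hm y
    rw [mul_pow, mul_pow, hσ, one_mul, mul_pow]
    calc m i ^ 2 * (y i - centre m B y) ^ 2 = m i * (m i * (y i - centre m B y) ^ 2) := by ring
      _ ≤ m i * g ^ 2 := mul_le_mul_of_nonneg_left (by linarith) hmi0.le
      _ ≤ (1 + μ) ^ 2 * g ^ 2 := mul_le_mul_of_nonneg_right (by nlinarith) (sq_nonneg _)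
  -- Two of the three units come from the linear term via `hz`, one from the quadratic term, which
  -- is at most `μ`.
  have hκ : |dispersion m B y' - dispersion m B y| ≤ 3 * (1 + μ) * g := by
    rw [abs_le] at hz ⊢
    have : μ ≤ (1 + μ) * g := by nlinarith
    constructor <;> nlinarith [hz.1, hz.2]
  refine (exp_mul_sub_exp_mul_le hg (one_le_gauge hm y') (gauge_sq hm y) (gauge_sq hm y') hκ hθ
    hθκ).trans ?_
  refine mul_le_mul_of_nonneg_left (add_le_add_left ?_ _) (Real.exp_nonneg _)
  refine mul_le_mul_of_nonneg_left ?_ (by positivity)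
  linarith

/-! ### The Lyapunov function -/

/-- The positions of the particles as real numbers. -/
def realPos {N : ℕ} (x : Config N) (i : Fin N) : ℝ := x.1 i

theorem realPos_jumpLeft {N : ℕ} (x : Config N) (i : Fin N) (h : IsBottom x i) :
    realPos (jumpLeft x i h) = fun j => realPos x j + if j = i then (-1 : ℝ) else 0 := by
  funext j
  simp only [realPos, jumpLeft, Pi.sub_apply, Pi.single_apply]
  split_ifs <;> simp [sub_eq_add_neg]

theorem realPos_jumpRight {N : ℕ} (x : Config N) (i : Fin N) (h : IsTop x i) :
    realPos (jumpRight x i h) = fun j => realPos x j + if j = i then (1 : ℝ) else 0 := by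
  funext j
  simp only [realPos, jumpRight, Pi.add_apply, Pi.single_apply]
  split_ifs <;> simp

theorem gauge_add_of_notMem {ι : Type*} [DecidableEq ι] (m : ι → ℝ) {B : Finset ι} (y : ι → ℝ)
    {i : ι} (hi : i ∉ B) (σ : ℝ) :
    gauge m B (fun j => y j + if j = i then σ else 0) = gauge m B y := by
  have h : ∀ j ∈ B, (y j + if j = i then σ else 0) = y j := fun j hj => by
    rw [if_neg (ne_of_mem_of_not_mem hj hi), add_zero]
  have hc : centre m B (fun j => y j + if j = i then σ else 0) = centre m B y := by
    rw [centre, centre]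
    congr 1
    exact Finset.sum_congr rfl fun j hj => by rw [h j hj]
  rw [gauge, gauge, dispersion, dispersion, hc]
  congr 2
  exact Finset.sum_congr rfl fun j hj => by rw [h j hj]

open Classical in
/-- The generator applied to the exponential of the gauge of a set `B` of particles, in terms of
the force acting on `B`. -/
theorem genFun_exp_gauge_le {N : ℕ} {m a b : Fin N → ℝ} (hm : ∀ i, 0 < m i) (ha : ∀ i, 0 ≤ a i)
    (hb : ∀ i, 0 ≤ b i) {B : Finset (Fin N)} (hB : 0 < ∑ i ∈ B, m i) {θ : ℝ} (hθ : 0 ≤ θ)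
    (hθκ : θ * (3 * (1 + ∑ i ∈ B, m i)) ≤ 1) (x : Config N) :
    genFun m a b (fun x => Real.exp (θ * gauge m B (realPos x))) x
      ≤ Real.exp (θ * gauge m B (realPos x)) * (θ / (2 * gauge m B (realPos x)) *
        (2 * ((∑ i ∈ B, if IsBottom x i then
            leftRate m a x i * (m i * (centre m B (realPos x) - realPos x i)) else 0)
          + ∑ i ∈ B, if IsTop x i then
            rightRate m b x i * (m i * (realPos x i - centre m B (realPos x))) else 0)
          + totalRate m a b * ∑ i ∈ B, m i)
        + θ ^ 2 * (3 * (1 + ∑ i ∈ B, m i)) ^ 2 * totalRate m a b) := by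
  -- The true rate `ρ` is kept in the force term, where signs matter, and replaced by the crude
  -- bound `R` in the error terms, so that these sum to `totalRate`.
  have hjump : ∀ i ∈ B, ∀ ρ R σ : ℝ, 0 ≤ ρ → ρ ≤ R → σ ^ 2 = 1 →
      ρ * (Real.exp (θ * gauge m B (fun j => realPos x j + if j = i then σ else 0))
        - Real.exp (θ * gauge m B (realPos x)))
      ≤ Real.exp (θ * gauge m B (realPos x)) * (θ / (2 * gauge m B (realPos x)) *
        (2 * (ρ * (m i * (σ * (realPos x i - centre m B (realPos x))))) + R * ∑ i ∈ B, m i)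
        + θ ^ 2 * (3 * (1 + ∑ i ∈ B, m i)) ^ 2 * R) := by
    intro i hi ρ R σ hρ hρR hσ
    have h := mul_le_mul_of_nonneg_left
      (exp_gauge_add_sub_le hm hB (realPos x) hi hσ hθ hθκ) hρ
    have hg := one_le_gauge (B := B) hm (realPos x)
    set g := gauge m B (realPos x)
    set z := m i * (σ * (realPos x i - centre m B (realPos x)))
    refine h.trans ?_
    rw [mul_left_comm]
    refine mul_le_mul_of_nonneg_left ?_ (Real.exp_nonneg _)
    have e1 := mul_le_mul_of_nonneg_left hρR
      (show 0 ≤ θ / (2 * g) * ∑ i ∈ B, m i by positivity)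
    have e2 := mul_le_mul_of_nonneg_left hρR
      (show 0 ≤ θ ^ 2 * (3 * (1 + ∑ i ∈ B, m i)) ^ 2 by positivity)
    linarith
  -- Covers blocked jumps and jumps of particles outside `B`, which contribute nothing.
  have hzero : ∀ R : ℝ, 0 ≤ R → 0 ≤ Real.exp (θ * gauge m B (realPos x)) *
      (θ / (2 * gauge m B (realPos x)) * (2 * 0 + R * ∑ i ∈ B, m i)
        + θ ^ 2 * (3 * (1 + ∑ i ∈ B, m i)) ^ 2 * R) := by
    intro R hR
    have hg := one_le_gauge (B := B) hm (realPos x)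
    set g := gauge m B (realPos x)
    positivity
  have hl : ∀ i, (if h : IsBottom x i then leftRate m a x i *
        (Real.exp (θ * gauge m B (realPos (jumpLeft x i h)))
          - Real.exp (θ * gauge m B (realPos x))) else 0)
      ≤ Real.exp (θ * gauge m B (realPos x)) * (θ / (2 * gauge m B (realPos x)) *
        (2 * (if i ∈ B then (if IsBottom x i then
            leftRate m a x i * (m i * (centre m B (realPos x) - realPos x i)) else 0) else 0)
          + (∑ j, |m j * a j / m i|) * ∑ i ∈ B, m i)
        + θ ^ 2 * (3 * (1 + ∑ i ∈ B, m i)) ^ 2 * ∑ j, |m j * a j / m i|) := by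
    intro i
    have hR : 0 ≤ ∑ j, |m j * a j / m i| := Finset.sum_nonneg fun _ _ => abs_nonneg _
    by_cases h : IsBottom x i
    · by_cases hi : i ∈ B
      · rw [dif_pos h, if_pos hi, if_pos h, realPos_jumpLeft]
        have := hjump i hi _ _ (-1) (leftRate_nonneg hm ha x i)
          ((le_abs_self _).trans (abs_leftRate_le m a x i)) (by norm_num)
        rwa [neg_one_mul, neg_sub] at this
      · rw [dif_pos h, if_neg hi, realPos_jumpLeft, gauge_add_of_notMem m _ hi, sub_self, mul_zero]
        exact hzero _ hR
    · rw [dif_neg h, if_neg h, ite_self]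
      exact hzero _ hR
  have hr : ∀ i, (if h : IsTop x i then rightRate m b x i *
        (Real.exp (θ * gauge m B (realPos (jumpRight x i h)))
          - Real.exp (θ * gauge m B (realPos x))) else 0)
      ≤ Real.exp (θ * gauge m B (realPos x)) * (θ / (2 * gauge m B (realPos x)) *
        (2 * (if i ∈ B then (if IsTop x i then
            rightRate m b x i * (m i * (realPos x i - centre m B (realPos x))) else 0) else 0)
          + (∑ j, |m j * b j / m i|) * ∑ i ∈ B, m i)
        + θ ^ 2 * (3 * (1 + ∑ i ∈ B, m i)) ^ 2 * ∑ j, |m j * b j / m i|) := by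
    intro i
    have hR : 0 ≤ ∑ j, |m j * b j / m i| := Finset.sum_nonneg fun _ _ => abs_nonneg _
    by_cases h : IsTop x i
    · by_cases hi : i ∈ B
      · rw [dif_pos h, if_pos hi, if_pos h, realPos_jumpRight]
        have := hjump i hi _ _ 1 (rightRate_nonneg hm hb x i)
          ((le_abs_self _).trans (abs_rightRate_le m b x i)) (by norm_num)
        rwa [one_mul] at this
      · rw [dif_pos h, if_neg hi, realPos_jumpRight, gauge_add_of_notMem m _ hi, sub_self, mul_zero]
        exact hzero _ hR
    · rw [dif_neg h, if_neg h, ite_self]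
      exact hzero _ hR
  refine (Finset.sum_le_sum fun i _ => add_le_add (hl i) (hr i)).trans (le_of_eq ?_)
  have hsum : ∀ F : Fin N → ℝ, ∑ i ∈ B, F i = ∑ i, if i ∈ B then F i else 0 := fun F => by simp
  rw [hsum (fun i => if IsBottom x i then _ else 0), hsum (fun i => if IsTop x i then _ else 0)]
  simp only [totalRate, rateBound, Finset.sum_add_distrib, ← Finset.mul_sum, ← Finset.sum_mul]
  ring

/-- Stability makes the total force on the block contracting. -/
theorem exists_force_le {N : ℕ} {m a b : Fin N → ℝ} (hm : ∀ i, 0 < m i)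
    {l r : ℕ} {f e : Fin N} (hf : (f : ℕ) = l) (he : (e : ℕ) + 1 = r) (hlr : l < r)
    (hstab : ∀ k : ℕ, l < k → k < r →
      Udiff m a b l k / Mdiff m l k < Udiff m a b l r / Mdiff m l r) :
    ∃ ε > 0, ∀ x : Config N,
      ∑ j ∈ blockFinset N l r,
          m j * (b j - a j) * (realPos x j - centre m (blockFinset N l r) (realPos x))
        ≤ -ε * (realPos x e - realPos x f) := by
  subst hf he
  have heN := e.2
  set B := blockFinset N f (e + 1) with hBdef
  have hMB : 0 < ∑ i ∈ B, m i := sum_blockFinset_pos hm hlr heN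
  -- Minus the mean velocity of the block; adding it to every velocity makes the total weight vanish
  -- and leaves the force about the centre of mass unchanged.
  set ρ := Udiff m a b f (e + 1) / Mdiff m f (e + 1) with hρ
  set w : Fin N → ℝ := fun i => m i * (b i - a i + ρ) with hw
  have hwsum : ∀ k, (f : ℕ) ≤ k →
      ∑ i ∈ blockFinset N f k, w i = ρ * Mdiff m f k - Udiff m a b f k := fun k hk => by
    rw [Mdiff_eq_sum m hk, Udiff_eq_sum m a b hk]
    simp only [hw, mul_add, Finset.sum_add_distrib, ← Finset.sum_mul]
    ring
  have hwpos : ∀ k, (f : ℕ) < k → k < e + 1 → 0 < ∑ i ∈ blockFinset N f k, w i := by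
    intro k hk hk'
    have hM : 0 < Mdiff m f k := by
      rw [Mdiff_eq_sum m hk.le]
      exact sum_blockFinset_pos hm hk (by omega)
    have h := hstab k hk hk'
    rw [div_lt_iff₀ hM] at h
    rw [hwsum k hk.le]
    linarith
  have hw0 : ∑ i ∈ B, w i = 0 := by
    rw [hBdef, hwsum _ hlr.le, hρ, div_mul_cancel₀, sub_self]
    rw [Mdiff_eq_sum m hlr.le]
    exact hMB.ne'
  obtain ⟨ε, hε, hεw⟩ : ∃ ε > 0, ∀ k, (f : ℕ) < k → k < e + 1 →
      ε ≤ ∑ i ∈ blockFinset N f k, w i := by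
    rcases (Finset.Ioo (f : ℕ) (e + 1)).eq_empty_or_nonempty with h0 | h0
    -- A one-particle block has no proper partial sums, so any positive `ε` works.
    · refine ⟨1, one_pos, fun k hk hk' => ?_⟩
      have : k ∈ Finset.Ioo (f : ℕ) (e + 1) := Finset.mem_Ioo.2 ⟨hk, hk'⟩
      rw [h0] at this
      simp at this
    · obtain ⟨k₀, hk₀, hmin⟩ := Finset.exists_min_image _
        (fun k => ∑ i ∈ blockFinset N f k, w i) h0
      rw [Finset.mem_Ioo] at hk₀
      exact ⟨_, hwpos k₀ hk₀.1 hk₀.2, fun k hk hk' => hmin k (Finset.mem_Ioo.2 ⟨hk, hk'⟩)⟩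
  refine ⟨ε, hε, fun x => ?_⟩
  have hmono : Monotone (realPos x) := fun i j hij => by
    have := x.2 hij
    simpa [realPos] using this
  have h := sum_mul_le_of_le_partialSum w (realPos x) hmono f.2 hεw e (by omega) (by omega) heN
  rw [← hBdef, hw0] at h
  have hc := sum_mul_sub_centre hMB (realPos x)
  set c := centre m B (realPos x)
  have hsplit : ∑ j ∈ B, m j * (b j - a j) * (realPos x j - c)
      = ∑ j ∈ B, w j * realPos x j - c * ∑ j ∈ B, w j - ρ * ∑ j ∈ B, m j * (realPos x j - c) := by
    simp only [Finset.mul_sum, ← Finset.sum_sub_distrib, hw]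
    exact Finset.sum_congr rfl fun j _ => by ring
  rw [hsplit, hw0, hc]
  linarith

/-- The witness is `exp (θ * gauge)`: the gauge is comparable to the span, and its downward drift
beats the `θ ^ 2` error once `θ` is small. -/
theorem exists_lyapunov {N : ℕ} {m a b : Fin N → ℝ} (hm : ∀ i, 0 < m i) (ha : ∀ i, 0 ≤ a i)
    (hb : ∀ i, 0 ≤ b i) {l r : ℕ} (hlr : l < r) (hrN : r ≤ N)
    (hstab : ∀ k : ℕ, l < k → k < r →
      Udiff m a b l k / Mdiff m l k < Udiff m a b l r / Mdiff m l r) :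
    ∃ (V : Config N → ℝ) (δ η c D : ℝ), 0 < δ ∧ 0 < η ∧ 0 ≤ c ∧ 0 ≤ D ∧
      (∀ x, Real.exp (δ * span (block N l r) x) ≤ V x) ∧
      (∀ x, V x ≤ Real.exp (D * (1 + span (block N l r) x))) ∧
      ∀ x, genFun m a b V x ≤ -η * V x + η * c := by
  let f : Fin N := ⟨l, by omega⟩
  let e : Fin N := ⟨r - 1, by omega⟩
  have hf : (f : ℕ) = l := rfl
  have he : (e : ℕ) + 1 = r := by simp only [e]; omega
  have hfB : f ∈ blockFinset N l r := mem_blockFinset.2 ⟨le_rfl, hlr⟩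
  have heB : e ∈ blockFinset N l r := mem_blockFinset.2 ⟨by omega, by omega⟩
  obtain ⟨ε, hε, hforce⟩ := exists_force_le (a := a) (b := b) hm hf he hlr hstab
  have hMB : 0 < ∑ i ∈ blockFinset N l r, m i := sum_blockFinset_pos hm hlr hrN
  have hspan : ∀ x : Config N, (span (block N l r) x : ℝ) = realPos x e - realPos x f := fun x => by
    rw [span_block_eq x hf he hlr]
    simp [realPos]
  have hlow : ∀ x : Config N, ∀ i ∈ blockFinset N l r, realPos x f ≤ realPos x i := by
    intro x i hi
    have := x.2 (show (f : ℕ) ≤ i from (mem_blockFinset.1 hi).1)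
    simpa [realPos] using this
  have hupp : ∀ x : Config N, ∀ i ∈ blockFinset N l r, realPos x i ≤ realPos x e := by
    intro x i hi
    have := x.2 (show (i : ℕ) ≤ e by have := (mem_blockFinset.1 hi).2; omega)
    simpa [realPos] using this
  have hfe : ∀ x : Config N, realPos x f ≤ realPos x e := fun x => hlow x e heB
  have hLam := totalRate_nonneg m a b
  have hgen := fun (θ : ℝ) (hθ : 0 ≤ θ) hθκ (x : Config N) =>
    genFun_exp_gauge_le hm ha hb hMB hθ hθκ x
  have hcentre : ∀ x : Config N, centre m (blockFinset N l r) (realPos x) ∈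
      Set.Icc (realPos x f) (realPos x e) := fun x => centre_mem_Icc hm hMB (hlow x) (hupp x)
  have hgauge : ∀ x : Config N, gauge m (blockFinset N l r) (realPos x)
      ≤ (1 + ∑ i ∈ blockFinset N l r, m i) * (1 + (realPos x e - realPos x f)) :=
    fun x => gauge_le hm hMB (hfe x) (hlow x) (hupp x)
  have hdiam : ∀ x : Config N, realPos x e - realPos x f
      ≤ ((√(m e))⁻¹ + (√(m f))⁻¹) * gauge m (blockFinset N l r) (realPos x) := fun x => by
    have h1 := (abs_le.1 (abs_sub_centre_le hm (realPos x) heB)).2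
    have h2 := (abs_le.1 (abs_sub_centre_le hm (realPos x) hfB)).1
    linarith
  have hone : ∀ x : Config N, 1 ≤ gauge m (blockFinset N l r) (realPos x) :=
    fun x => one_le_gauge hm _
  have hdrift : ∀ x : Config N, _ :=
    fun x => (add_le_add
      (sum_left_force_le hm ha hf he x (hcentre x).1 (hcentre x).2)
      (sum_right_force_le hm hb hf he x (hcentre x).1 (hcentre x).2))
  have hforce' : ∀ x : Config N,
      (∑ j ∈ blockFinset N l r,
          m j * a j * (centre m (blockFinset N l r) (realPos x) - x.1 j))
        + (∑ j ∈ blockFinset N l r,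
          m j * b j * (x.1 j - centre m (blockFinset N l r) (realPos x)))
        ≤ -ε * (realPos x e - realPos x f) := fun x => by
    refine le_trans (le_of_eq ?_) (hforce x)
    rw [← Finset.sum_add_distrib]
    refine Finset.sum_congr rfl fun j _ => ?_
    simp only [realPos]
    ring
  have hdrift' := fun x => (hdrift x).trans (hforce' x)
  clear hdrift hforce hforce' hcentre
  set μ := ∑ i ∈ blockFinset N l r, m i with hμ
  set Λ := totalRate m a b with hΛ
  set κ := 3 * (1 + μ) with hκ
  have hκ0 : 0 < κ := by positivity
  -- the exponent is chosen so that the quadratic error is half of the linear drift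
  obtain ⟨θ, hθ, hθκ, hθΛ⟩ : ∃ θ > 0, θ * κ ≤ 1 ∧ θ * (κ ^ 2 * Λ) ≤ ε / (2 * (1 + μ)) := by
    refine ⟨min (1 / κ) (ε / (2 * (1 + μ)) / (κ ^ 2 * Λ + 1)), by positivity, ?_, ?_⟩
    · exact (mul_le_mul_of_nonneg_right (min_le_left _ _) hκ0.le).trans
        (le_of_eq (by field_simp))
    · refine (mul_le_mul_of_nonneg_right (min_le_right _ _) (by positivity)).trans ?_
      rw [div_mul_eq_mul_div]
      exact div_le_of_le_mul₀ (by positivity) (by positivity)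
        (mul_le_mul_of_nonneg_left (by linarith) (by positivity))
  set q := (√(m e))⁻¹ + (√(m f))⁻¹ with hq
  have hq0 : 0 < q := by
    have h1 := Real.sqrt_pos.2 (hm e)
    have h2 := Real.sqrt_pos.2 (hm f)
    positivity
  -- The leading drift is `-2ζ`, of which the quadratic error consumes at most `ζ`. `H` collects the
  -- terms of order `1 / g`, and `K` bounds their contribution where `g` is too small for `ζ / 2` to
  -- absorb them.
  set ζ := θ * (ε / (2 * (1 + μ))) with hζ
  have hζ0 : 0 < ζ := by positivity
  set H := ε + Λ * μ / 2 with hH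
  have hH0 : 0 < H := by positivity
  set K := θ * H * Real.exp (θ * (2 * θ * H / ζ)) with hK
  refine ⟨fun x => Real.exp (θ * gauge m (blockFinset N l r) (realPos x)), θ / q, ζ / 2,
    K / (ζ / 2), θ * (1 + μ), by positivity, by positivity, by positivity, by positivity, ?_, ?_, ?_⟩
  · intro x
    refine Real.exp_le_exp.2 ?_
    rw [hspan, div_mul_eq_mul_div, mul_div_assoc]
    refine mul_le_mul_of_nonneg_left ?_ hθ.le
    rw [div_le_iff₀ hq0]
    linarith [hdiam x]
  · intro x
    refine Real.exp_le_exp.2 ?_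
    rw [hspan, mul_assoc]
    exact mul_le_mul_of_nonneg_left (hgauge x) hθ.le
  · intro x
    refine (hgen θ hθ.le hθκ x).trans ?_
    have hd := hdrift' x
    have hg1 := hone x
    have hgu := hgauge x
    beta_reduce
    set g := gauge m (blockFinset N l r) (realPos x)
    set E := Real.exp (θ * g) with hE
    have hE0 : 0 < E := Real.exp_pos _
    have hg0 : 0 < g := by linarith
    set Δ := realPos x e - realPos x f
    have hΔ : g / (1 + μ) - 1 ≤ Δ := by
      rw [sub_le_iff_le_add, div_le_iff₀ (by positivity)]
      linarith
    rw [mul_div_cancel₀ K (by positivity)]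
    have hstep : ∀ F : ℝ, F ≤ -ε * Δ →
        θ / (2 * g) * (2 * F + Λ * μ) + θ ^ 2 * κ ^ 2 * Λ ≤ -ζ + θ * H / g := by
      intro F hF
      have h1 : θ / (2 * g) * (2 * F + Λ * μ)
          ≤ θ / (2 * g) * (2 * (-ε * (g / (1 + μ) - 1)) + Λ * μ) := by
        refine mul_le_mul_of_nonneg_left ?_ (by positivity)
        nlinarith
      have h2 : θ / (2 * g) * (2 * (-ε * (g / (1 + μ) - 1)) + Λ * μ) = -(2 * ζ) + θ * H / g := by
        rw [hζ, hH]
        field_simp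
        ring
      have h3 : θ ^ 2 * κ ^ 2 * Λ ≤ ζ := by
        rw [hζ]
        calc θ ^ 2 * κ ^ 2 * Λ = θ * (θ * (κ ^ 2 * Λ)) := by ring
          _ ≤ _ := mul_le_mul_of_nonneg_left hθΛ hθ.le
      linarith
    refine (mul_le_mul_of_nonneg_left (hstep _ hd) hE0.le).trans ?_
    -- Beyond this threshold `θ * H / g ≤ ζ / 2`, leaving the drift `-ζ / 2`; below it `E` itself is
    -- bounded.
    by_cases hcase : 2 * θ * H / ζ ≤ g
    · have h1 : θ * H / g ≤ ζ / 2 := by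
        rw [div_le_iff₀ hζ0] at hcase
        rw [div_le_iff₀ hg0]
        linarith
      have hK0 : 0 ≤ K := by positivity
      nlinarith
    · rw [not_le] at hcase
      have h1 : θ * H / g ≤ θ * H := div_le_self (by positivity) hg1
      have h2 : E ≤ Real.exp (θ * (2 * θ * H / ζ)) :=
        Real.exp_le_exp.2 (mul_le_mul_of_nonneg_left hcase.le hθ.le)
      have h3 : E * (θ * H / g) ≤ K := by
        rw [hK, mul_comm]
        exact mul_le_mul h1 h2 hE0.le (by positivity)
      nlinarith

/-! ### Estimates for the process -/

/-- The indicator function of a set of configurations. -/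
def ind {N : ℕ} (S : Set (Config N)) : Config N →ᵇ ℝ :=
  BoundedContinuousFunction.indicator S (isClopen_discrete S)

theorem ind_of_mem {N : ℕ} {S : Set (Config N)} {x : Config N} (h : x ∈ S) : ind S x = 1 :=
  Set.indicator_of_mem h _

theorem ind_of_notMem {N : ℕ} {S : Set (Config N)} {x : Config N} (h : x ∉ S) : ind S x = 0 :=
  Set.indicator_of_notMem h _

theorem ind_nonneg {N : ℕ} (S : Set (Config N)) (x : Config N) : 0 ≤ ind S x :=
  Set.indicator_nonneg (fun _ _ => zero_le_one) x

theorem past_mono {N : ℕ} {Ω : Type*} (X : ℝ≥0 → Ω → Config N) : Monotone (past X) := fun _ t hst =>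
  iSup_le fun u => le_iSup (fun v : Set.Iic t => MeasurableSpace.comap (X v) inferInstance)
    ⟨u, le_trans u.2 hst⟩

theorem measurable_past {N : ℕ} {Ω : Type*} (X : ℝ≥0 → Ω → Config N) (t : ℝ≥0) :
    Measurable[past X t] (X t) :=
  (comap_measurable (X t)).mono
    (le_iSup (fun v : Set.Iic t => MeasurableSpace.comap (X v) inferInstance) ⟨t, Set.self_mem_Iic⟩)
    le_rfl

section Estimates

variable {N : ℕ} {Ω : Type*} [MeasurableSpace Ω] {m a b : Fin N → ℝ} {x₀ : Config N}
  {X : ℝ≥0 → Ω → Config N} {P : Measure Ω}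

theorem IsElasticSystem.past_le (hX : IsElasticSystem m a b x₀ X P) (t : ℝ≥0) :
    past X t ≤ ‹MeasurableSpace Ω› :=
  iSup_le fun s => (hX.measurable s).comap_le

theorem IsElasticSystem.integrable_comp [IsFiniteMeasure P] (hX : IsElasticSystem m a b x₀ X P)
    (t : ℝ≥0) (f : Config N →ᵇ ℝ) : Integrable (fun ω => f (X t ω)) P :=
  Integrable.of_bound
    ((Measurable.of_discrete (f := f)).comp (hX.measurable t)).aestronglyMeasurable ‖f‖
    (ae_of_all _ fun _ => f.norm_coe_le_norm _)

theorem IsElasticSystem.integral_comp [IsProbabilityMeasure P]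
    (hX : IsElasticSystem m a b x₀ X P) (t : ℝ≥0) (f : Config N →ᵇ ℝ) :
    ∫ ω, f (X t ω) ∂P = semigroup m a b t f x₀ := by
  rw [← integral_condExp (hX.past_le 0), integral_congr_ae (hX.markov 0 t zero_le f)]
  have h : (fun ω => semigroup m a b (t - 0) f (X 0 ω)) =ᵐ[P] fun _ => semigroup m a b t f x₀ := by
    filter_upwards [hX.initial] with ω hω
    rw [hω, tsub_zero]
  rw [integral_congr_ae h]
  simp

theorem IsElasticSystem.integral_ind (hX : IsElasticSystem m a b x₀ X P) (t : ℝ≥0)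
    (S : Set (Config N)) : ∫ ω, ind S (X t ω) ∂P = P.real {ω | X t ω ∈ S} := by
  have hS : MeasurableSet {ω | X t ω ∈ S} := hX.measurable t (MeasurableSet.of_discrete (s := S))
  rw [← integral_indicator_one hS]
  refine integral_congr_ae (ae_of_all _ fun ω => ?_)
  by_cases h : X t ω ∈ S
  · simp [ind_of_mem h, Set.indicator, h]
  · simp [ind_of_notMem h, Set.indicator, h]

/-- Markov's inequality with `exp v * 1_S` as the bounded minorant of `V`. -/
theorem IsElasticSystem.measure_le [IsProbabilityMeasure P] (hX : IsElasticSystem m a b x₀ X P)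
    (hm : ∀ i, 0 < m i) (ha : ∀ i, 0 ≤ a i) (hb : ∀ i, 0 ≤ b i) {V : Config N → ℝ}
    (hV : ∀ x, 0 ≤ V x) {η c : ℝ} (hη : 0 ≤ η) (hc : 0 ≤ c)
    (hLV : ∀ x, genFun m a b V x ≤ -η * V x + η * c) {S : Set (Config N)} {v : ℝ}
    (hS : ∀ x ∈ S, Real.exp v ≤ V x) (t : ℝ≥0) :
    P {ω | X t ω ∈ S} ≤ ENNReal.ofReal ((V x₀ + c) * Real.exp (-v)) := by
  have hf : ∀ x, (Real.exp v • ind S) x ≤ V x := fun x => by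
    rw [BoundedContinuousFunction.smul_apply]
    by_cases h : x ∈ S
    · simpa [ind_of_mem h] using hS x h
    · simpa [ind_of_notMem h] using hV x
  have h := semigroup_le_of_genFun_le hm ha hb hV hη hc hLV hf t x₀
  rw [map_smul, BoundedContinuousFunction.smul_apply, smul_eq_mul, ← hX.integral_comp,
    hX.integral_ind] at h
  rw [← ofReal_measureReal]
  refine ENNReal.ofReal_le_ofReal ?_
  rw [Real.exp_neg, ← div_eq_mul_inv, le_div_iff₀ (Real.exp_pos v), mul_comm]
  exact h

/-- Maximal inequality along an arithmetic progression of times: a visited state is kept for a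
unit of time with probability bounded below. -/
theorem IsElasticSystem.measure_exists_le [IsProbabilityMeasure P]
    (hX : IsElasticSystem m a b x₀ X P) (hm : ∀ i, 0 < m i) (ha : ∀ i, 0 ≤ a i)
    (hb : ∀ i, 0 ≤ b i) (S : Set (Config N)) (u h : ℝ≥0) (n : ℕ) :
    P {ω | ∃ k ≤ n, X (u + k * h) ω ∈ S}
      ≤ ENNReal.ofReal (Real.exp (totalRate m a b * (n * h))) * P {ω | X (u + n * h) ω ∈ S} := by
  set lam := totalRate m a b
  have hlam : 0 ≤ lam := totalRate_nonneg m a b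
  let 𝒢 : Filtration ℕ ‹MeasurableSpace Ω› :=
    { seq := fun k => past X (u + k * h)
      mono' := fun i j hij => past_mono X (by gcongr)
      le' := fun k => hX.past_le _ }
  -- The weight offsets the loss factor `exp (-λ h)` in `exp_mul_le_semigroup`, making `F k` along
  -- the path a submartingale to which Doob's inequality applies.
  let F : ℕ → Config N →ᵇ ℝ := fun k => Real.exp (lam * (k * h)) • ind S
  have hF0 : ∀ k x, 0 ≤ F k x := fun k x =>
    mul_nonneg (Real.exp_nonneg _) (ind_nonneg S x)
  let Y : ℕ → Ω → ℝ := fun k ω => F k (X (u + k * h) ω)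
  have hsub : Submartingale Y 𝒢 P := by
    refine submartingale_nat (fun k => ?_) (fun k => hX.integrable_comp _ _) fun k => ?_
    · exact ((Measurable.of_discrete (f := F k)).comp
        (measurable_past X (u + k * h))).stronglyMeasurable
    · have hle : u + k * h ≤ u + (k + 1 : ℕ) * h := by
        gcongr
        exact k.le_succ
      have hstep : u + (k + 1 : ℕ) * h - (u + k * h) = h := by
        push_cast
        rw [add_mul, one_mul, ← add_assoc, add_tsub_cancel_left]
      have hmk := hX.markov _ _ hle (F (k + 1))
      rw [hstep] at hmk
      filter_upwards [hmk] with ω hω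
      change F k (X (u + k * h) ω) ≤ (P[fun ω => F (k + 1) (X (u + (k + 1 : ℕ) * h) ω) |
        past X (u + k * h)]) ω
      rw [hω]
      refine le_trans (le_of_eq ?_)
        (exp_mul_le_semigroup hm ha hb le_rfl (hF0 (k + 1)) h (X (u + k * h) ω))
      simp only [F, BoundedContinuousFunction.smul_apply, smul_eq_mul]
      rw [← mul_assoc (Real.exp (-_)), ← Real.exp_add]
      congr 2
      push_cast
      ring
  have hmax := maximal_ineq hsub (fun k ω => hF0 k _) (ε := 1) n
  rw [ENNReal.coe_one, one_mul] at hmax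
  refine (measure_mono ?_).trans (hmax.trans ?_)
  · rintro ω ⟨k, hk, hkS⟩
    change ((1 : ℝ≥0) : ℝ) ≤ _
    rw [Finset.le_sup'_iff]
    refine ⟨k, Finset.mem_range.2 (by omega), ?_⟩
    change _ ≤ Real.exp (lam * (k * h)) * ind S _
    rw [ind_of_mem hkS, mul_one]
    exact Real.one_le_exp (by positivity)
  · rw [← ofReal_measureReal (μ := P) (s := {ω | X (u + n * h) ω ∈ S}), ← hX.integral_ind,
      ← ENNReal.ofReal_mul (Real.exp_nonneg _), ← integral_const_mul]
    exact ENNReal.ofReal_le_ofReal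
      (setIntegral_le_integral (hX.integrable_comp _ _) (ae_of_all _ fun ω => hF0 n _))

/-- Refine the time grid. In a discrete space a right-continuous path is constant just after each
time, so a visit to `S` is seen by every sufficiently fine grid. -/
theorem IsElasticSystem.measure_exists_Icc_le [IsProbabilityMeasure P]
    (hX : IsElasticSystem m a b x₀ X P) (hm : ∀ i, 0 < m i) (ha : ∀ i, 0 ≤ a i)
    (hb : ∀ i, 0 ≤ b i) (S : Set (Config N)) (u : ℝ≥0) :
    P {ω | ∃ v ≤ 1, X (u + v) ω ∈ S}
      ≤ ENNReal.ofReal (Real.exp (totalRate m a b)) * P {ω | X (u + 1) ω ∈ S} := by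
  let E : ℕ → Set Ω := fun j => {ω | ∃ k ≤ j + 1, X (u + k * ((j + 1 : ℕ) : ℝ≥0)⁻¹) ω ∈ S}
  have hE : ∀ j, P (E j)
      ≤ ENNReal.ofReal (Real.exp (totalRate m a b)) * P {ω | X (u + 1) ω ∈ S} := fun j => by
    have h := hX.measure_exists_le hm ha hb S u ((j + 1 : ℕ) : ℝ≥0)⁻¹ (j + 1)
    have h1 : ((j + 1 : ℕ) : ℝ≥0) * ((j + 1 : ℕ) : ℝ≥0)⁻¹ = 1 := mul_inv_cancel₀ (by positivity)
    have h2 : ((j + 1 : ℕ) : ℝ) * (((j + 1 : ℕ) : ℝ≥0)⁻¹ : ℝ≥0) = 1 := by exact_mod_cast h1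
    rwa [h1, h2, mul_one] at h
  -- The grids are not nested, but these tail intersections increase, so continuity from below
  -- applies.
  let D : ℕ → Set Ω := fun J => ⋂ j, ⋂ (_ : J ≤ j), E j
  have hD : Monotone D := fun J J' hJ =>
    Set.subset_iInter₂ fun j hj => Set.iInter₂_subset j (hJ.trans hj)
  have hsub : {ω | ∃ v ≤ 1, X (u + v) ω ∈ S} ≤ᵐ[P] ⋃ J, D J := by
    filter_upwards [hX.rightContinuous] with ω hω
    rintro ⟨v, hv, hvS⟩
    have hev : ∀ᶠ t in nhdsWithin (u + v) (Set.Ici (u + v)), X t ω = X (u + v) ω := by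
      have := hω (u + v)
      rwa [ContinuousWithinAt, nhds_discrete, tendsto_pure] at this
    let k : ℕ → ℕ := fun j => ⌈v * (j + 1 : ℕ)⌉₊
    have hle : ∀ j, v ≤ k j * ((j + 1 : ℕ) : ℝ≥0)⁻¹ := fun j => by
      rw [← div_eq_mul_inv, le_div_iff₀ (by positivity)]
      exact Nat.le_ceil _
    have hge : ∀ j, (k j : ℝ≥0) * ((j + 1 : ℕ) : ℝ≥0)⁻¹ ≤ v + ((j + 1 : ℕ) : ℝ≥0)⁻¹ := fun j => by
      rw [← div_eq_mul_inv, div_le_iff₀ (by positivity), add_mul,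
        inv_mul_cancel₀ (by positivity)]
      exact (Nat.ceil_lt_add_one zero_le).le
    have hk : ∀ j, k j ≤ j + 1 := fun j =>
      Nat.ceil_le.2 (mul_le_of_le_one_left zero_le hv)
    have hlim : Tendsto (fun j => u + k j * ((j + 1 : ℕ) : ℝ≥0)⁻¹) atTop
        (nhdsWithin (u + v) (Set.Ici (u + v))) := by
      refine tendsto_nhdsWithin_iff.2 ⟨?_, Eventually.of_forall fun j => ?_⟩
      · refine Tendsto.const_add u (tendsto_of_tendsto_of_tendsto_of_le_of_le tendsto_const_nhds ?_
          hle hge)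
        have h0 : Tendsto (fun j : ℕ => ((j + 1 : ℕ) : ℝ≥0)⁻¹) atTop (nhds 0) :=
          (tendsto_inv_atTop_nhds_zero_nat (𝕜 := ℝ≥0)).comp (tendsto_add_atTop_nat 1)
        simpa using h0.const_add v
      · exact add_le_add_right (hle j) u
    obtain ⟨J, hJ⟩ := eventually_atTop.1 (hlim.eventually hev)
    refine Set.mem_iUnion.2 ⟨J, Set.mem_iInter₂.2 fun j hj => ⟨k j, hk j, ?_⟩⟩
    rw [hJ j hj]
    exact hvS
  refine (measure_mono_ae hsub).trans ?_
  rw [hD.measure_iUnion]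
  exact iSup_le fun J => (measure_mono (Set.iInter₂_subset J le_rfl)).trans (hE J)

/-- Exponential tails uniform in time imply logarithmic growth along almost every path. -/
theorem IsElasticSystem.limsup_div_log_lt_top [IsProbabilityMeasure P]
    (hX : IsElasticSystem m a b x₀ X P) (hm : ∀ i, 0 < m i) (ha : ∀ i, 0 ≤ a i)
    (hb : ∀ i, 0 ≤ b i) (φ : Config N → ℝ) {K δ : ℝ} (hδ : 0 < δ)
    (htail : ∀ s, 0 ≤ s → ∀ t, P {ω | s ≤ φ (X t ω)} ≤ ENNReal.ofReal (K * Real.exp (-δ * s))) :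
    ∀ᵐ ω ∂P, limsup (fun t : ℝ≥0 => ((φ (X t ω) / Real.log (t : ℝ) : ℝ) : EReal)) atTop < ⊤ := by
  -- The level is exceeded somewhere in `[n + 1, n + 2]`. The factor `2 / δ` turns the exponential
  -- tail into the summable `(n + 1) ^ (-2)`.
  let A : ℕ → Set Ω := fun n =>
    {ω | ∃ v ≤ 1, X ((n + 1 : ℕ) + v) ω ∈ {x | 2 / δ * Real.log (n + 1 : ℕ) ≤ φ x}}
  have hA : ∀ n, P (A n) ≤ ENNReal.ofReal
      (Real.exp (totalRate m a b) * K * (1 / ((n + 1 : ℕ) : ℝ) ^ 2)) := fun n => by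
    refine (hX.measure_exists_Icc_le hm ha hb _ _).trans ?_
    have hn : (1 : ℝ) ≤ (n + 1 : ℕ) := by
      push_cast
      linarith [n.cast_nonneg (α := ℝ)]
    have h := htail (2 / δ * Real.log (n + 1 : ℕ))
      (mul_nonneg (by positivity) (Real.log_nonneg hn)) ((n + 1 : ℕ) + 1)
    have he : Real.exp (-δ * (2 / δ * Real.log (n + 1 : ℕ))) = 1 / ((n + 1 : ℕ) : ℝ) ^ 2 := by
      have : -δ * (2 / δ * Real.log (n + 1 : ℕ)) = -(Real.log (((n + 1 : ℕ) : ℝ) ^ 2)) := by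
        rw [Real.log_pow]
        field_simp
        push_cast
        ring
      rw [this, Real.exp_neg, Real.exp_log (by positivity), one_div]
    rw [he] at h
    rw [mul_assoc, ENNReal.ofReal_mul (Real.exp_nonneg _)]
    exact mul_le_mul_right h _
  have hsum : ∑' n, P (A n) ≠ ⊤ := by
    refine ne_top_of_le_ne_top ?_ (ENNReal.tsum_le_tsum hA)
    refine Summable.tsum_ofReal_ne_top (Summable.mul_left _ ?_)
    exact (summable_nat_add_iff (f := fun n : ℕ => 1 / (n : ℝ) ^ 2) 1).2
      (Real.summable_one_div_nat_pow.2 one_lt_two)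
  filter_upwards [ae_eventually_notMem hsum] with ω hω
  obtain ⟨n₀, hn₀⟩ := eventually_atTop.1 hω
  refine lt_of_le_of_lt (limsup_le_of_le (a := ((2 / δ : ℝ) : EReal)) (h := ?_))
    (EReal.coe_lt_top _)
  -- The offset `2` gives `n ≥ n₀ + 1 ≥ 1` for `⌊t⌋₊ = n + 1`, hence a positive logarithm to divide
  -- by.
  filter_upwards [eventually_ge_atTop ((n₀ + 2 : ℕ) : ℝ≥0)] with t ht
  rw [EReal.coe_le_coe_iff]
  have hfloor : n₀ + 2 ≤ ⌊t⌋₊ := Nat.le_floor ht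
  obtain ⟨n, hn⟩ : ∃ n, ⌊t⌋₊ = n + 1 := ⟨⌊t⌋₊ - 1, by omega⟩
  have h1 : ((n + 1 : ℕ) : ℝ≥0) ≤ t := hn ▸ Nat.floor_le zero_le
  have h2 : t ≤ ((n + 1 : ℕ) : ℝ≥0) + 1 := hn ▸ (Nat.lt_floor_add_one t).le
  have hnot := hn₀ n (by omega)
  have hlt : φ (X t ω) < 2 / δ * Real.log (n + 1 : ℕ) := by
    by_contra hcon
    refine hnot ⟨t - (n + 1 : ℕ), tsub_le_iff_left.2 h2, ?_⟩
    rw [add_tsub_cancel_of_le h1]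
    exact not_lt.1 hcon
  have h1' : ((n + 1 : ℕ) : ℝ) ≤ t := by exact_mod_cast h1
  have hn1 : (1 : ℝ) < (n + 1 : ℕ) := by
    have : 1 < n + 1 := by omega
    exact_mod_cast this
  have hlog : Real.log (n + 1 : ℕ) ≤ Real.log t := Real.log_le_log (by linarith) h1'
  rw [div_le_iff₀ ((Real.log_pos hn1).trans_le hlog)]
  exact hlt.le.trans (mul_le_mul_of_nonneg_left hlog (by positivity))

end Estimates

theorem span_block_nonneg {N l r : ℕ} (hlr : l < r) (hrN : r ≤ N) (x : Config N) :
    0 ≤ span (block N l r) x := by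
  rw [span_block_eq x (f := ⟨l, by omega⟩) (e := ⟨r - 1, by omega⟩) rfl (by simp only; omega) hlr]
  exact sub_nonneg.2 (x.2 (show l ≤ r - 1 by omega))

end Elastic

end

theorem proposition1 {N : ℕ} (m a b : Fin N → ℝ)
    (hm : ∀ i, 0 < m i) (ha : ∀ i, 0 ≤ a i) (hb : ∀ i, 0 ≤ b i)
    (l r : ℕ) (hlr : l < r) (hrN : r ≤ N)
    (hstab : ∀ k : ℕ, l < k → k < r →
      Elastic.Udiff m a b l k / Elastic.Mdiff m l k
        < Elastic.Udiff m a b l r / Elastic.Mdiff m l r) :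
    ∃ C δ : ℝ, 0 ≤ C ∧ 0 < δ ∧
      ∀ (Ω : Type*) [MeasurableSpace Ω] (P : Measure Ω) [IsProbabilityMeasure P]
        (x₀ : Elastic.Config N) (X : ℝ≥0 → Ω → Elastic.Config N),
        Elastic.IsElasticSystem m a b x₀ X P →
        (∀ s : ℝ, 0 ≤ s →
          (⨆ t : ℝ≥0, P {ω | s ≤ (Elastic.span (Elastic.block N l r) (X t ω) : ℝ)}) ≤
            ENNReal.ofReal
              (C * (1 + Real.exp (C * (Elastic.span (Elastic.block N l r) x₀ : ℝ)))
                * Real.exp (-δ * s))) ∧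
        ∀ᵐ ω ∂P,
          limsup (fun t : ℝ≥0 =>
            (((Elastic.span (Elastic.block N l r) (X t ω) : ℝ) / Real.log (t : ℝ) : ℝ) : EReal))
            atTop < ⊤ := by
  obtain ⟨V, δ, η, c, D, hδ, hη, hc, hD, hVlow, hVupp, hLV⟩ :=
    Elastic.exists_lyapunov hm ha hb hlr hrN hstab
  have hV0 : ∀ x, 0 ≤ V x := fun x => (Real.exp_nonneg _).trans (hVlow x)
  -- One constant dominates the prefactor `exp D`, the exponent `D` and the additive `c`.
  refine ⟨Real.exp D + D + c, δ, by positivity, hδ, fun Ω _ P _ x₀ X hX => ?_⟩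
  set C := Real.exp D + D + c with hC
  set Δ₀ : ℝ := (Elastic.span (Elastic.block N l r) x₀ : ℝ)
  have hΔ₀ : 0 ≤ Δ₀ := Int.cast_nonneg (Elastic.span_block_nonneg hlr hrN x₀)
  have hconst : V x₀ + c ≤ C * (1 + Real.exp (C * Δ₀)) := by
    have h1 : V x₀ ≤ Real.exp D * Real.exp (D * Δ₀) := by
      rw [← Real.exp_add]
      refine (hVupp x₀).trans (le_of_eq ?_)
      rw [mul_add, mul_one]
    have hDC : D ≤ C := by linarith [Real.exp_nonneg D]
    have h2 : Real.exp (D * Δ₀) ≤ Real.exp (C * Δ₀) :=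
      Real.exp_le_exp.2 (mul_le_mul_of_nonneg_right hDC hΔ₀)
    have h3 : Real.exp D * Real.exp (D * Δ₀) ≤ C * Real.exp (C * Δ₀) :=
      mul_le_mul (by linarith) h2 (Real.exp_nonneg _) (by positivity)
    have h4 : c ≤ C := by linarith [Real.exp_nonneg D]
    linarith
  have htail : ∀ s : ℝ, 0 ≤ s → ∀ t : ℝ≥0,
      P {ω | s ≤ (Elastic.span (Elastic.block N l r) (X t ω) : ℝ)} ≤
        ENNReal.ofReal (C * (1 + Real.exp (C * Δ₀)) * Real.exp (-δ * s)) := by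
    intro s _ t
    refine (hX.measure_le hm ha hb hV0 hη.le hc hLV (v := δ * s)
      (S := {x | s ≤ (Elastic.span (Elastic.block N l r) x : ℝ)}) ?_ t).trans ?_
    · intro x hx
      exact (Real.exp_le_exp.2 (mul_le_mul_of_nonneg_left hx hδ.le)).trans (hVlow x)
    · rw [neg_mul]
      exact ENNReal.ofReal_le_ofReal
        (mul_le_mul_of_nonneg_right hconst (Real.exp_nonneg _))
  exact ⟨fun s hs => iSup_le fun t => htail s hs t,
    hX.limsup_div_log_lt_top hm ha hb (fun x => (Elastic.span (Elastic.block N l r) x : ℝ)) hδ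
      htail⟩
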